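/- \textbf{Model.} There are $M$ arms and $K\ge 1$ plays, a probing budget $1\le I\le M$, and a non-decreasing overhead function $\alpha:\{0,\dots,I\}\to[0,1]$ with $\alpha(0)=0$, $\alpha(I)=1$. In each round $t=1,\dots,T$ nature draws, independently over rounds, arms and plays, and independently of each other, resources $D_{t,m}\in\{1,\dots,D_{\max}\}$ with law $p_m$ and rewards $X_{t,m,k}\in[0,1]$ with law $\nu_{m,k}$ and mean $\mu_{m,k}$. The learner chooses a set $S_t$ of at most $I$ arms to probe, sees $D_{t,m}$ and $(X_{t,m,k})_k$ for $m\in S_t$, and then assigns each play to at most one arm; $C_{t,m}$ is the set of plays assigned to arm $m$. For real numbers $x_k$ let $\mathrm{top}_n(x;C)$ be the sum of the $\min(n,|C|)$ largest of the $x_k$, $k\in C$. The total reward of the round is $$\mathcal R_t^{\rm total}=(1-\alpha(|S_t|))\Big(\sum_{m\in S_t}\mathrm{top}_{D_{t,m}}(X_{t,m,\cdot};C_{t,m})+\sum_{m\notin S_t}\sum_{d=1}^{D_{\max}}p_m(d)\,\mathrm{top}_{d}(\mu_{m,\cdot};C_{t,m})\Big).$$ On each arm, units of resource go first to the assigned plays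 with the largest $X_{t,m,k}$ (probed arms) or the largest $\mu_{m,k}$ (other arms), ties being broken by the index $k$. After the assignment the learner also sees $D_{t,m}$ for every arm to which a play was assigned and $X_{t,m,k}$ for every assigned play that received a unit of resource. An online algorithm is any (possibly randomized) measurable rule for $S_t$ and for the assignment based on what was seen so far. It may depend on $M,K,D_{\max},I,\alpha,T$ and the $p_m$, but not on the $\nu_{m,k}$. For $S\subseteq\{1,\dots,M\}$ with $|S|\le I$ let $R(S)=(1-\alpha(|S|))f(S)$, where $f(S)$ is the expectation, over the values seen by probing $S$, of the maximum over all assignments of the bracket above (with $S$ in place of $S_t$). Let $R(S^\star)=\max_{|S|\le I}R(S)$, and let the regret be $$\mathcal R_{\rm regret}(T)=\sum_{t=1}^T R(S^\star)-\sum_{t=1}^T\mathcal R_t^{\rm total}.$$ \textbf{Theorem (Lower Bound for Regret).} For every $M\ge 2$ there is a constant $c>0$, depending only on $M$, such that for all $K$, $D_{\max}$, $I$, $\alpha$ as above, all resource laws $p_m$ on $\{1,\dots,D_{\max}\}$, every horizon $T\ge1$ and every online algorithm, there are reward distributions $\nu_{m,k}$ on $[0,1]$ for which $\mathcal R_{\rm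 regret}(T)$ is integrable and $$\mathbb E[\mathcal R_{\rm regret}(T)]\ \ge\ c\sqrt T .$$ -/

import Mathlib

open MeasureTheory

namespace PUCS

/-- What nature draws in one round: the resource `D m` of every arm and the reward `X m k` of every
arm-play pair. -/
abbrev Outcome (M K : ℕ) : Type := (Fin M → ℕ) × (Fin M → Fin K → ℝ)

/-- What probing reveals: for a probed arm its resource and its reward vector, and `Sum.inl ()`
for an arm that is not probed. -/
abbrev ProbeObs (M K : ℕ) : Type := Fin M → Unit ⊕ (ℕ × (Fin K → ℝ))

/-- What playing reveals: the resource of each arm that was assigned at least one play, and the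
reward of each arm-play pair for which the play was assigned to the arm and received a unit of
resource; everything else is `Sum.inl ()`. -/
abbrev PlayObs (M K : ℕ) : Type := (Fin M → Unit ⊕ ℕ) × (Fin M → Fin K → Unit ⊕ ℝ)

/-- Everything the learner sees in one round. -/
abbrev Feedback (M K : ℕ) : Type := ProbeObs M K × PlayObs M K

/-- An action profile: every play is assigned to at most one arm. -/
abbrev Assignment (M K : ℕ) : Type := Fin K → Option (Fin M)

/-- The set `C m` of plays assigned to arm `m`. -/
def plays {M K : ℕ} (C : Assignment M K) (m : Fin M) : Finset (Fin K) :=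
  Finset.univ.filter (fun k => C k = some m)

/-- The plays of `C` that get a unit of resource when `n` units are available and plays with a larger
`key` have priority (ties are broken by the index): the first `min n |C|` plays of `C` in the order
of decreasing `key`. -/
noncomputable def served {K : ℕ} (key : Fin K → ℝ) (C : Finset (Fin K)) (n : ℕ) :
    Finset (Fin K) := by
  classical
  exact C.filter
    (fun k => (C.filter (fun j => key k < key j ∨ (key j = key k ∧ j < k))).card < n)

/-- The sum of the `min n |C|` largest of the numbers `x k`, `k ∈ C`. -/
noncomputable def topSum {K : ℕ} (x : Fin K → ℝ) (C : Finset (Fin K)) (n : ℕ) : ℝ :=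
  ∑ k ∈ served x C n, x k

/-- The reward means `μ m k`. -/
noncomputable def mean {M K : ℕ} (ν : Fin M → Fin K → ProbabilityMeasure ℝ) (m : Fin M)
    (k : Fin K) : ℝ :=
  ∫ x, x ∂(ν m k : Measure ℝ)

/-- The expected total reward of an arm that is not probed, with reward means `μ`, resource law `p`
and assigned plays `C`. -/
noncomputable def unprobedReward {K : ℕ} (Dmax : ℕ) (p : PMF ℕ) (μ : Fin K → ℝ)
    (C : Finset (Fin K)) : ℝ :=
  ∑ d ∈ Finset.Icc 1 Dmax, (p d).toReal * topSum μ C d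

/-- The total reward in a round, before the probing overhead is deducted: arms in `S` are probed
and contribute their realized reward, the others contribute their expected reward. -/
noncomputable def grossReward {M K : ℕ} (Dmax : ℕ) (p : Fin M → PMF ℕ)
    (ν : Fin M → Fin K → ProbabilityMeasure ℝ) (S : Finset (Fin M)) (w : Outcome M K)
    (C : Assignment M K) : ℝ :=
  ∑ m ∈ S, topSum (w.2 m) (plays C m) (w.1 m)
    + ∑ m ∈ Sᶜ, unprobedReward Dmax (p m) (mean ν m) (plays C m)

/-- The total reward `(1 - α(|S|)) (⋯)` of a round. -/
noncomputable def totalReward {M K : ℕ} (Dmax : ℕ) (α : ℕ → ℝ) (p : Fin M → PMF ℕ)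
    (ν : Fin M → Fin K → ProbabilityMeasure ℝ) (S : Finset (Fin M)) (w : Outcome M K)
    (C : Assignment M K) : ℝ :=
  (1 - α S.card) * grossReward Dmax p ν S w C

/-- The law of a round: all resources and all rewards are independent, with laws `p m`, `ν m k`. -/
noncomputable def outcomeLaw {M K : ℕ} (p : Fin M → PMF ℕ)
    (ν : Fin M → Fin K → ProbabilityMeasure ℝ) : Measure (Outcome M K) :=
  (Measure.pi fun m => (p m).toMeasure).prod
    (Measure.pi fun m => Measure.pi fun k => (ν m k : Measure ℝ))

/-- The value of the best assignment given the probing set and the probed values. -/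
noncomputable def hTotal {M K : ℕ} (Dmax : ℕ) (p : Fin M → PMF ℕ)
    (ν : Fin M → Fin K → ProbabilityMeasure ℝ) (S : Finset (Fin M)) (w : Outcome M K) : ℝ :=
  (Finset.univ : Finset (Assignment M K)).sup' Finset.univ_nonempty (grossReward Dmax p ν S w)

/-- `R(S) = (1 - α(|S|)) f(S)`, where `f(S) = E[h_total(S)]`. -/
noncomputable def probingValue {M K : ℕ} (Dmax : ℕ) (α : ℕ → ℝ) (p : Fin M → PMF ℕ)
    (ν : Fin M → Fin K → ProbabilityMeasure ℝ) (S : Finset (Fin M)) : ℝ :=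
  (1 - α S.card) * ∫ w, hTotal Dmax p ν S w ∂(outcomeLaw p ν)

/-- `R(S⋆)`, the largest `R(S)` over the probing sets of at most `I` arms. -/
noncomputable def optimalValue {M K : ℕ} (Dmax I : ℕ) (α : ℕ → ℝ) (p : Fin M → PMF ℕ)
    (ν : Fin M → Fin K → ProbabilityMeasure ℝ) : ℝ :=
  ((Finset.univ : Finset (Finset (Fin M))).filter (fun S => S.card ≤ I)).sup'
    ⟨∅, by simp⟩ (probingValue Dmax α p ν)

/-- The observation after probing `S`. -/
def probeObs {M K : ℕ} (S : Finset (Fin M)) (w : Outcome M K) : ProbeObs M K :=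
  fun m => if m ∈ S then Sum.inr (w.1 m, w.2 m) else Sum.inl ()

/-- The observation after probing `S` and playing `C`. On probed arms the priority among plays is by
realized reward, on the others by mean reward. -/
noncomputable def playObs {M K : ℕ} (ν : Fin M → Fin K → ProbabilityMeasure ℝ)
    (S : Finset (Fin M)) (w : Outcome M K) (C : Assignment M K) : PlayObs M K :=
  (fun m => if (plays C m).Nonempty then Sum.inr (w.1 m) else Sum.inl (),
   fun m k =>
    if k ∈ served (if m ∈ S then w.2 m else mean ν m) (plays C m) (w.1 m)
    then Sum.inr (w.2 m k) else Sum.inl ())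

/-- A (possibly randomized) online algorithm with probing budget `I`. In each round `t` (numbered
from `0`) it first chooses the set of arms to probe, from its internal randomness and the feedback of
the earlier rounds, and then, having also seen the result of the probing, the assignment. -/
structure OnlineAlgorithm (M K I : ℕ) (Seed : Type*) [MeasurableSpace Seed] where
  probe : (t : ℕ) → Seed → (Fin t → Feedback M K) → Finset (Fin M)
  assign : (t : ℕ) → Seed → (Fin t → Feedback M K) → ProbeObs M K → Assignment M K
  card_probe_le : ∀ t u h, (probe t u h).card ≤ I
  measurable_probe : ∀ t S,
    MeasurableSet {x : Seed × (Fin t → Feedback M K) | probe t x.1 x.2 = S}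
  measurable_assign : ∀ t C,
    MeasurableSet {x : Seed × (Fin t → Feedback M K) × ProbeObs M K |
      assign t x.1 x.2.1 x.2.2 = C}

namespace OnlineAlgorithm

variable {M K I : ℕ} {Seed : Type*} [MeasurableSpace Seed]

/-- The assignment made in round `t` with history `h` when nature draws `w`. -/
def action (A : OnlineAlgorithm M K I Seed) (t : ℕ) (u : Seed) (h : Fin t → Feedback M K)
    (w : Outcome M K) : Assignment M K :=
  A.assign t u h (probeObs (A.probe t u h) w)

/-- The feedback of the first `t` rounds, in which nature draws `ω 0, …, ω (t - 1)`. -/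
noncomputable def history (A : OnlineAlgorithm M K I Seed)
    (ν : Fin M → Fin K → ProbabilityMeasure ℝ) (u : Seed) :
    (t : ℕ) → (Fin t → Outcome M K) → Fin t → Feedback M K
  | 0, _ => Fin.elim0
  | t + 1, ω =>
    let h := history A ν u t (Fin.init ω)
    let w := ω (Fin.last t)
    Fin.snoc h
      (probeObs (A.probe t u h) w, playObs ν (A.probe t u h) w (A.action t u h w))

/-- The total reward of the algorithm in round `t`. -/
noncomputable def reward (A : OnlineAlgorithm M K I Seed) (Dmax : ℕ) (α : ℕ → ℝ)
    (p : Fin M → PMF ℕ) (ν : Fin M → Fin K → ProbabilityMeasure ℝ) {T : ℕ} (u : Seed)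
    (ω : Fin T → Outcome M K) (t : Fin T) : ℝ :=
  let h := A.history ν u t (fun i => ω (Fin.castLE t.isLt.le i))
  totalReward Dmax α p ν (A.probe t u h) (ω t) (A.action t u h (ω t))

/-- The regret over `T` rounds: the cumulative reward `T · R(S⋆)` of the optimal probing policy minus
that of the algorithm. -/
noncomputable def regret (A : OnlineAlgorithm M K I Seed) (Dmax : ℕ) (α : ℕ → ℝ)
    (p : Fin M → PMF ℕ) (ν : Fin M → Fin K → ProbabilityMeasure ℝ) (T : ℕ)
    (x : Seed × (Fin T → Outcome M K)) : ℝ :=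
  ∑ _t : Fin T, optimalValue Dmax I α p ν - ∑ t : Fin T, A.reward Dmax α p ν x.1 x.2 t

end OnlineAlgorithm

/-- The joint law of the internal randomness of the algorithm and of `T` i.i.d. rounds. -/
noncomputable def runLaw {M K : ℕ} {Seed : Type*} [MeasurableSpace Seed] (ρ : Measure Seed)
    (p : Fin M → PMF ℕ) (ν : Fin M → Fin K → ProbabilityMeasure ℝ) (T : ℕ) :
    Measure (Seed × (Fin T → Outcome M K)) :=
  ρ.prod (Measure.pi fun _ : Fin T => outcomeLaw p ν)

end PUCS

/-!
On the hard instance only one play `k₀` can earn anything, so a round consists of choosing an arm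
for it. On the distinguished arm `m₀` its reward is `9/16` or `7/16`, with bias `b`, and on every
other arm it is `0`, `1/2` or `1` with mean `1/2`; the best unprobed arm is `m₀` if `b > 1/2` and
any other arm if `b < 1/2`. The biases `b` and `1 - b` with `b = 1/2 + 1/(4√T)` are not
distinguished reliably by `T` rounds, even under full information, because the product of the two
likelihood ratios is the constant `(4 b (1 - b)) ^ T`.

In each round some loss is incurred under one of the two biases. If the probing set `S` is
expensive, probing nothing is better by a constant. If it contains `m₀`, swapping `m₀` for an arm
outside `S` gains a constant, since a known reward of `1` is worth more than one that never reaches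
`1`. If `m₀ ∉ S`, all other arms show `1/2` with probability at least `2 ^ (-M)`, and then the
assignment cannot be right for both biases, which costs `(b - 1/2) / 8`. As the bias is of
order `1/√T` away from `1/2`, the `T` rounds cost a multiple of `√T`.
-/

namespace PUCS

open ProbabilityTheory
open scoped ENNReal

section FiniteValued

variable {X β γ : Type*} [MeasurableSpace X] [Finite β] {f : X → β}

theorem measurable_comp_of_measurableSet_fiber [MeasurableSpace γ]
    (hf : ∀ b, MeasurableSet {x | f x = b}) {g : β → X → γ} (hg : ∀ b, Measurable (g b)) :
    Measurable fun x => g (f x) x := by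
  intro s hs
  have hpre : (fun x => g (f x) x) ⁻¹' s = ⋃ b, {x | f x = b} ∩ g b ⁻¹' s := by
    ext x
    simp
  rw [hpre]
  exact MeasurableSet.iUnion fun b => (hf b).inter (hg b hs)

theorem measurableSet_fiber_comp (hf : ∀ b, MeasurableSet {x | f x = b}) {g : β → X → γ} {c : γ}
    (hg : ∀ b, MeasurableSet {x | g b x = c}) : MeasurableSet {x | g (f x) x = c} :=
  measurableSet_setOfPred.2 <|
    measurable_comp_of_measurableSet_fiber hf fun b => measurableSet_setOfPred.1 (hg b)

theorem integrable_comp_of_measurableSet_fiber [NormedAddCommGroup γ] {μ : Measure X}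
    (hf : ∀ b, MeasurableSet {x | f x = b}) {g : β → X → γ} (hg : ∀ b, Integrable (g b) μ) :
    Integrable (fun x => g (f x) x) μ := by
  classical
  have := Fintype.ofFinite β
  have hsum : (fun x => g (f x) x) = fun x => ∑ b, {x | f x = b}.indicator (g b) x := by
    funext x
    simp [Set.indicator_apply]
  rw [hsum]
  exact integrable_finsetSum _ fun b _ => (hg b).indicator (hf b)

end FiniteValued

section Density

section Pi

variable {ι : Type*} [Fintype ι] {X : ι → Type*} [∀ i, MeasurableSpace (X i)]
  (μ : ∀ i, Measure (X i)) [∀ i, IsProbabilityMeasure (μ i)]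

theorem lintegral_pi_prod {f : ∀ i, X i → ℝ≥0∞} (hf : ∀ i, Measurable (f i)) :
    ∫⁻ x, ∏ i, f i (x i) ∂Measure.pi μ = ∏ i, ∫⁻ x, f i x ∂μ i := by
  refine (lintegral_prod_eq_prod_lintegral_of_indepFun Finset.univ
    (fun i (x : ∀ i, X i) => f i (x i))
    (iIndepFun_pi fun i => (hf i).aemeasurable)
    fun i => (hf i).comp (measurable_pi_apply i)).trans ?_
  exact Finset.prod_congr rfl fun i _ => (measurePreserving_eval μ i).lintegral_comp (hf i)

theorem pi_withDensity {f : ∀ i, X i → ℝ≥0∞} (hf : ∀ i, Measurable (f i))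
    [∀ i, SigmaFinite ((μ i).withDensity (f i))] :
    Measure.pi (fun i => (μ i).withDensity (f i))
      = (Measure.pi μ).withDensity fun x => ∏ i, f i (x i) := by
  classical
  refine Measure.pi_eq fun s hs => ?_
  have hind : (Set.univ.pi s).indicator (fun x : ∀ i, X i => ∏ i, f i (x i))
      = fun x => ∏ i, (s i).indicator (f i) (x i) := by
    funext x
    simp only [Set.indicator_apply, Set.mem_univ_pi, Finset.prod_ite_zero, Finset.mem_univ,
      true_imp_iff]
  rw [withDensity_apply _ (MeasurableSet.univ_pi hs),
    ← lintegral_indicator (MeasurableSet.univ_pi hs), hind,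
    lintegral_pi_prod μ fun i => (hf i).indicator (hs i)]
  refine Finset.prod_congr rfl fun i _ => ?_
  rw [withDensity_apply _ (hs i), lintegral_indicator (hs i)]

theorem pi_withDensity_single {ν : ∀ i, Measure (X i)} [∀ i, SigmaFinite (ν i)] (i₀ : ι)
    {f : X i₀ → ℝ≥0∞} (hf : Measurable f) (h₀ : ν i₀ = (μ i₀).withDensity f)
    (h : ∀ i, i ≠ i₀ → ν i = μ i) :
    Measure.pi ν = (Measure.pi μ).withDensity fun x => f (x i₀) := by
  classical
  let g : ∀ i, X i → ℝ≥0∞ := Function.update (fun _ _ => 1) i₀ f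
  have hg₀ : g i₀ = f := Function.update_self _ _ _
  have hg : ∀ i, i ≠ i₀ → g i = fun _ => 1 := fun i hi => Function.update_of_ne hi _ _
  have hν : ∀ i, ν i = (μ i).withDensity (g i) := fun i => by
    obtain rfl | hi := eq_or_ne i i₀
    · rw [hg₀, h₀]
    · rw [hg i hi, h i hi]
      exact withDensity_one.symm
  have hgm : ∀ i, Measurable (g i) := fun i => by
    obtain rfl | hi := eq_or_ne i i₀
    · rwa [hg₀]
    · rw [hg i hi]
      exact measurable_const
  have hprod : (fun x : ∀ i, X i => ∏ i, g i (x i)) = fun x => f (x i₀) := by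
    funext x
    rw [Finset.prod_eq_single i₀ (fun i _ hi => by rw [hg i hi]) (by simp), hg₀]
  have : ∀ i, SigmaFinite ((μ i).withDensity (g i)) := fun i => hν i ▸ inferInstance
  rw [← hprod, ← pi_withDensity μ hgm, ← funext hν]

end Pi

section TwoPoint

variable {Ω : Type*} [MeasurableSpace Ω]

theorem mul_measureReal_le_integral_add {ξ P Q : Measure Ω} (hP : ξ ≤ P) (hQ : ξ ≤ Q)
    {F G : Ω → ℝ} (hF : Integrable F P) (hG : Integrable G Q) (hF0 : ∀ x, 0 ≤ F x)
    (hG0 : ∀ x, 0 ≤ G x) {E : Set Ω} (hE : MeasurableSet E) {δ : ℝ}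
    (hδ : ∀ᵐ x ∂ξ, x ∈ E → δ ≤ F x + G x) :
    δ * ξ.real E ≤ ∫ x, F x ∂P + ∫ x, G x ∂Q := by
  have hle : ENNReal.ofReal δ * ξ E ≤ ENNReal.ofReal (∫ x, F x ∂P + ∫ x, G x ∂Q) :=
    calc ENNReal.ofReal δ * ξ E = ∫⁻ _ in E, ENNReal.ofReal δ ∂ξ := (setLIntegral_const E _).symm
      _ ≤ ∫⁻ x in E, (ENNReal.ofReal (F x) + ENNReal.ofReal (G x)) ∂ξ :=
          setLIntegral_mono_ae' hE <| hδ.mono fun x hx hxE =>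
            (ENNReal.ofReal_le_ofReal (hx hxE)).trans ENNReal.ofReal_add_le
      _ ≤ ∫⁻ x, (ENNReal.ofReal (F x) + ENNReal.ofReal (G x)) ∂ξ := setLIntegral_le_lintegral _ _
      _ = ∫⁻ x, ENNReal.ofReal (F x) ∂ξ + ∫⁻ x, ENNReal.ofReal (G x) ∂ξ :=
          lintegral_add_left' (hF.1.aemeasurable.mono_measure hP).ennreal_ofReal _
      _ ≤ ∫⁻ x, ENNReal.ofReal (F x) ∂P + ∫⁻ x, ENNReal.ofReal (G x) ∂Q :=
          add_le_add (lintegral_mono' hP le_rfl) (lintegral_mono' hQ le_rfl)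
      _ = ENNReal.ofReal (∫ x, F x ∂P + ∫ x, G x ∂Q) := by
          rw [ENNReal.ofReal_add (integral_nonneg hF0) (integral_nonneg hG0),
            ofReal_integral_eq_lintegral_ofReal hF (ae_of_all _ hF0),
            ofReal_integral_eq_lintegral_ofReal hG (ae_of_all _ hG0)]
  calc δ * ξ.real E ≤ (ENNReal.ofReal δ * ξ E).toReal := by
        rw [ENNReal.toReal_mul, ENNReal.toReal_ofReal']
        exact mul_le_mul_of_nonneg_right (le_max_left δ 0) measureReal_nonneg
    _ ≤ ∫ x, F x ∂P + ∫ x, G x ∂Q :=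
        ENNReal.toReal_le_of_le_ofReal
          (add_nonneg (integral_nonneg hF0) (integral_nonneg hG0)) hle

theorem four_mul_mul_le_min (a b : ℝ≥0∞) : 4 * (a * b) ≤ 4 * min a b + a * b * (a + b) := by
  have four_mul_le : ∀ c : ℝ≥0∞, 4 * c ≤ 4 + c * c := fun c => by
    induction c with
    | top => simp
    | coe c =>
      have hc : 4 * (c : ℝ) ≤ 4 + c * c := by nlinarith [sq_nonneg ((c : ℝ) - 2)]
      exact_mod_cast hc
  rcases le_total a b with h | h
  · calc 4 * (a * b) = a * (4 * b) := by ring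
      _ ≤ a * (4 + b * b) := by gcongr; exact four_mul_le b
      _ = 4 * min a b + a * b * b := by rw [min_eq_left h]; ring
      _ ≤ 4 * min a b + a * b * (a + b) := by gcongr; exact le_add_self
  · calc 4 * (a * b) = b * (4 * a) := by ring
      _ ≤ b * (4 + a * a) := by gcongr; exact four_mul_le a
      _ = 4 * min a b + a * b * a := by rw [min_eq_right h]; ring
      _ ≤ 4 * min a b + a * b * (a + b) := by gcongr; exact le_self_add

theorem le_two_mul_lintegral_min {P : Measure Ω} [IsProbabilityMeasure P] {f g : Ω → ℝ≥0∞}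
    (hf : Measurable f) (hg : Measurable g) (hf1 : ∫⁻ x, f x ∂P ≤ 1) (hg1 : ∫⁻ x, g x ∂P ≤ 1)
    {c : ℝ≥0∞} (hc : c ≠ ∞) (hfg : ∀ x, f x * g x = c) :
    c ≤ 2 * ∫⁻ x, min (f x) (g x) ∂P := by
  have hint : 4 * c ≤ 4 * ∫⁻ x, min (f x) (g x) ∂P + c * (1 + 1) :=
    calc 4 * c = ∫⁻ x, 4 * (f x * g x) ∂P := by simp [hfg]
      _ ≤ ∫⁻ x, (4 * min (f x) (g x) + c * (f x + g x)) ∂P := by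
          gcongr with x
          exact hfg x ▸ four_mul_mul_le_min (f x) (g x)
      _ = 4 * ∫⁻ x, min (f x) (g x) ∂P + c * (∫⁻ x, f x ∂P + ∫⁻ x, g x ∂P) := by
          rw [lintegral_add_right _ (by fun_prop), lintegral_const_mul _ (hf.min hg),
            lintegral_const_mul _ (by fun_prop), lintegral_add_left hf]
      _ ≤ 4 * ∫⁻ x, min (f x) (g x) ∂P + c * (1 + 1) := by gcongr
  have hdouble : 2 * c ≤ 2 * (2 * ∫⁻ x, min (f x) (g x) ∂P) := by
    have hc2 : 2 * c ≠ ∞ := ENNReal.mul_ne_top ENNReal.ofNat_ne_top hc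
    refine ENNReal.le_of_add_le_add_right hc2 ?_
    calc 2 * c + 2 * c = 4 * c := by ring
      _ ≤ 4 * ∫⁻ x, min (f x) (g x) ∂P + c * (1 + 1) := hint
      _ = 2 * (2 * ∫⁻ x, min (f x) (g x) ∂P) + 2 * c := by ring
  exact (ENNReal.mul_le_mul_iff_right two_ne_zero ENNReal.ofNat_ne_top).1 hdouble

theorem mul_div_two_le_integral_add {P : Measure Ω} [IsProbabilityMeasure P] {f g : Ω → ℝ≥0∞}
    (hf : Measurable f) (hg : Measurable g) (hf1 : ∫⁻ x, f x ∂P ≤ 1) (hg1 : ∫⁻ x, g x ∂P ≤ 1)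
    {κ : ℝ} (hfg : ∀ x, f x * g x = ENNReal.ofReal κ) {F G : Ω → ℝ}
    (hF : Integrable F (P.withDensity f)) (hG : Integrable G (P.withDensity g))
    (hF0 : ∀ x, 0 ≤ F x) (hG0 : ∀ x, 0 ≤ G x) {δ : ℝ} (hδ0 : 0 ≤ δ) (hδ : ∀ x, δ ≤ F x + G x) :
    δ * (κ / 2) ≤ ∫ x, F x ∂P.withDensity f + ∫ x, G x ∂P.withDensity g := by
  have hle := mul_measureReal_le_integral_add (ξ := P.withDensity fun x => min (f x) (g x))
    (withDensity_mono (ae_of_all _ fun x => min_le_left _ _))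
    (withDensity_mono (ae_of_all _ fun x => min_le_right _ _)) hF hG hF0 hG0 .univ
    (ae_of_all _ fun x _ => hδ x)
  refine le_trans (mul_le_mul_of_nonneg_left ?_ hδ0) hle
  have hfin : ∫⁻ x, min (f x) (g x) ∂P ≠ ∞ :=
    ((lintegral_mono fun x => min_le_left _ _).trans_lt
      (hf1.trans_lt ENNReal.one_lt_top)).ne
  have hκ := (ENNReal.ofReal_le_iff_le_toReal
    (ENNReal.mul_ne_top ENNReal.ofNat_ne_top hfin)).1
      (le_two_mul_lintegral_min hf hg hf1 hg1 ENNReal.ofReal_ne_top hfg)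
  rw [ENNReal.toReal_mul, ENNReal.toReal_ofNat] at hκ
  rw [Measure.real, withDensity_apply _ .univ, setLIntegral_univ]
  linarith

end TwoPoint

end Density

section Measurability

variable {M K : ℕ} {X : Type*} [MeasurableSpace X]

theorem mem_served {key : Fin K → ℝ} {C : Finset (Fin K)} {n : ℕ} {k : Fin K} :
    k ∈ served key C n ↔
      k ∈ C ∧ ∑ j ∈ C, (if key k < key j ∨ (key j = key k ∧ j < k) then 1 else 0) < n := by
  classical
  rw [served, Finset.mem_filter, Finset.card_filter]

theorem served_congr {x y : Fin K → ℝ} (h : ∀ i j, x i < x j ↔ y i < y j) (C : Finset (Fin K))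
    (n : ℕ) : served x C n = served y C n := by
  have h' : ∀ i j, x i = x j ↔ y i = y j := fun i j => by
    simp only [le_antisymm_iff, ← not_lt, h]
  ext k
  simp only [mem_served, h, h']

theorem measurableSet_mem_served {f : X → Fin K → ℝ} {n : X → ℕ} (hf : Measurable f)
    (hn : Measurable n) (C : Finset (Fin K)) (k : Fin K) :
    MeasurableSet {x | k ∈ served (f x) C (n x)} := by
  simp only [mem_served]
  have hk : ∀ j, Measurable fun x => f x j := fun j => (measurable_pi_apply j).comp hf
  refine (MeasurableSet.const _).inter (measurableSet_lt ?_ hn)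
  refine Finset.measurable_sum _ fun j _ => Measurable.ite ?_ measurable_const measurable_const
  exact (measurableSet_lt (hk k) (hk j)).union
    ((measurableSet_eq_fun (hk j) (hk k)).inter (MeasurableSet.const _))

theorem measurable_probeObs (S : Finset (Fin M)) :
    Measurable (probeObs S : Outcome M K → ProbeObs M K) := by
  refine measurable_pi_lambda _ fun m => ?_
  unfold probeObs
  split_ifs
  · exact measurable_inr.comp (by fun_prop)
  · exact measurable_const

theorem measurable_playObs (ν : Fin M → Fin K → ProbabilityMeasure ℝ) (S : Finset (Fin M))
    (C : Assignment M K) : Measurable fun w => playObs ν S w C := by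
  unfold playObs
  refine Measurable.prodMk (measurable_pi_lambda _ fun m => ?_)
    (measurable_pi_lambda _ fun m => measurable_pi_lambda _ fun k => ?_)
  · split_ifs
    · exact measurable_inr.comp (by fun_prop)
    · exact measurable_const
  · refine Measurable.ite (measurableSet_mem_served ?_ (by fun_prop) _ _)
      (measurable_inr.comp (by fun_prop)) measurable_const
    split_ifs
    · fun_prop
    · exact measurable_const

namespace OnlineAlgorithm

variable {I : ℕ} {Seed : Type*} [MeasurableSpace Seed] (A : OnlineAlgorithm M K I Seed) (t : ℕ)
  {u : X → Seed} {h : X → Fin t → Feedback M K} {w : X → Outcome M K}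

theorem measurableSet_probe (hu : Measurable u) (hh : Measurable h) (S : Finset (Fin M)) :
    MeasurableSet {x | A.probe t (u x) (h x) = S} :=
  (hu.prodMk hh) (A.measurable_probe t S)

theorem measurableSet_action (hu : Measurable u) (hh : Measurable h) (hw : Measurable w)
    (C : Assignment M K) : MeasurableSet {x | A.action t (u x) (h x) (w x) = C} :=
  measurableSet_fiber_comp (g := fun S x => A.assign t (u x) (h x) (probeObs S (w x)))
    (A.measurableSet_probe t hu hh)
    fun S => (hu.prodMk (hh.prodMk ((measurable_probeObs S).comp hw))) (A.measurable_assign t C)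

theorem measurableSet_probe_action (hu : Measurable u) (hh : Measurable h) (hw : Measurable w)
    (SC : Finset (Fin M) × Assignment M K) :
    MeasurableSet {x | (A.probe t (u x) (h x), A.action t (u x) (h x) (w x)) = SC} := by
  simp only [Prod.ext_iff]
  exact (A.measurableSet_probe t hu hh _).inter (A.measurableSet_action t hu hh hw _)

theorem measurable_history (ν : Fin M → Fin K → ProbabilityMeasure ℝ) :
    Measurable fun x : Seed × (Fin t → Outcome M K) => A.history ν x.1 t x.2 := by
  induction t with
  | zero => exact measurable_pi_lambda _ fun i => i.elim0
  | succ t ih =>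
    have hh : Measurable fun x : Seed × (Fin (t + 1) → Outcome M K) =>
        A.history ν x.1 t (Fin.init x.2) :=
      ih.comp (measurable_fst.prodMk (measurable_pi_lambda _ fun i =>
        (measurable_pi_apply (Fin.castSucc i)).comp measurable_snd))
    have hw : Measurable fun x : Seed × (Fin (t + 1) → Outcome M K) => x.2 (Fin.last t) :=
      (measurable_pi_apply _).comp measurable_snd
    refine measurable_pi_lambda _ fun i => ?_
    simp only [history]
    refine Fin.lastCases ?_ (fun i => ?_) i
    · simp only [Fin.snoc_last]
      exact measurable_comp_of_measurableSet_fiber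
        (A.measurableSet_probe_action t measurable_fst hh hw)
        (g := fun SC x => (probeObs SC.1 (x.2 (Fin.last t)),
          playObs ν SC.1 (x.2 (Fin.last t)) SC.2))
        fun SC => ((measurable_probeObs SC.1).prodMk (measurable_playObs ν SC.1 SC.2)).comp hw
    · simp only [Fin.snoc_castSucc]
      exact (measurable_pi_apply i).comp hh

/-- The order of the means decides which plays an unprobed arm serves, and nothing else about the
reward laws enters the feedback. -/
theorem history_congr {ν ν' : Fin M → Fin K → ProbabilityMeasure ℝ}
    (h : ∀ m i j, mean ν m i < mean ν m j ↔ mean ν' m i < mean ν' m j) (u : Seed)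
    (ω : Fin t → Outcome M K) : A.history ν u t ω = A.history ν' u t ω := by
  have hplay : ∀ S w C, playObs (M := M) (K := K) ν S w C = playObs ν' S w C := by
    intro S w C
    unfold playObs
    congr! 5 with m k
    split_ifs
    · rfl
    · rw [served_congr (h m)]
  induction t with
  | zero => rfl
  | succ t ih => simp only [history, ih, hplay]

end OnlineAlgorithm

end Measurability

section Integrability

variable {M K : ℕ} (Dmax : ℕ) (α : ℕ → ℝ) (p : Fin M → PMF ℕ)
  {ν : Fin M → Fin K → ProbabilityMeasure ℝ}

instance (ν : Fin M → Fin K → ProbabilityMeasure ℝ) : IsProbabilityMeasure (outcomeLaw p ν) := by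
  unfold outcomeLaw
  infer_instance

theorem measurePreserving_resource (ν : Fin M → Fin K → ProbabilityMeasure ℝ) (m : Fin M) :
    MeasurePreserving (fun w : Outcome M K => w.1 m) (outcomeLaw p ν) (p m).toMeasure :=
  (measurePreserving_eval _ m).comp measurePreserving_fst

theorem measurePreserving_rewards (ν : Fin M → Fin K → ProbabilityMeasure ℝ) (m : Fin M)
    (k : Fin K) :
    MeasurePreserving (fun w : Outcome M K => w.2 m k) (outcomeLaw p ν) (ν m k) :=
  (measurePreserving_eval _ k).comp <|
    (measurePreserving_eval (fun m => Measure.pi fun k => (ν m k : Measure ℝ)) m).comp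
      measurePreserving_snd

theorem integrable_topSum {X : Type*} [MeasurableSpace X] {μ : Measure X} {f : X → Fin K → ℝ}
    {n : X → ℕ} (hf : Measurable f) (hn : Measurable n) (hfi : ∀ k, Integrable (fun x => f x k) μ)
    (C : Finset (Fin K)) : Integrable (fun x => topSum (f x) C (n x)) μ := by
  classical
  have hsum : (fun x => topSum (f x) C (n x))
      = fun x => ∑ k, {x | k ∈ served (f x) C (n x)}.indicator (fun x => f x k) x := by
    funext x
    simp [topSum, Set.indicator_apply]
  rw [hsum]
  exact integrable_finsetSum _ fun k _ => (hfi k).indicator (measurableSet_mem_served hf hn C k)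

theorem integrable_grossReward (hν : ∀ m k, Integrable (fun x => x) (ν m k : Measure ℝ))
    (S : Finset (Fin M)) (C : Assignment M K) :
    Integrable (fun w => grossReward Dmax p ν S w C) (outcomeLaw p ν) :=
  (integrable_finsetSum _ fun m _ => integrable_topSum (by fun_prop) (by fun_prop)
    (fun k => (measurePreserving_rewards p ν m k).integrable_comp_of_integrable (hν m k)) _).add
    (integrable_const _)

theorem integrable_totalReward (hν : ∀ m k, Integrable (fun x => x) (ν m k : Measure ℝ))
    (S : Finset (Fin M)) (C : Assignment M K) :
    Integrable (fun w => totalReward Dmax α p ν S w C) (outcomeLaw p ν) :=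
  (integrable_grossReward Dmax p hν S C).const_mul _

theorem integrable_hTotal (hν : ∀ m k, Integrable (fun x => x) (ν m k : Measure ℝ))
    (S : Finset (Fin M)) : Integrable (hTotal Dmax p ν S) (outcomeLaw p ν) := by
  have hsup : hTotal Dmax p ν S = (Finset.univ : Finset (Assignment M K)).sup'
      Finset.univ_nonempty fun C w => grossReward Dmax p ν S w C := by
    funext w
    rw [Finset.sup'_apply]
    rfl
  rw [hsup]
  exact Finset.sup'_induction (p := fun f => Integrable f (outcomeLaw p ν)) _ _
    (fun _ h₁ _ h₂ => h₁.sup h₂) fun C _ => integrable_grossReward Dmax p hν S C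

variable {Seed : Type*} [MeasurableSpace Seed] (ρ : Measure Seed) [IsProbabilityMeasure ρ]
  {I T : ℕ} (A : OnlineAlgorithm M K I Seed)

instance (ν : Fin M → Fin K → ProbabilityMeasure ℝ) : IsProbabilityMeasure (runLaw ρ p ν T) := by
  unfold runLaw
  infer_instance

theorem measurePreserving_round (ν : Fin M → Fin K → ProbabilityMeasure ℝ) (t : Fin T) :
    MeasurePreserving (fun x : Seed × (Fin T → Outcome M K) => x.2 t) (runLaw ρ p ν T)
      (outcomeLaw p ν) :=
  (measurePreserving_eval _ t).comp measurePreserving_snd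

namespace OnlineAlgorithm

theorem integrable_reward (hν : ∀ m k, Integrable (fun x => x) (ν m k : Measure ℝ)) (t : Fin T) :
    Integrable (fun x => A.reward Dmax α p ν x.1 x.2 t) (runLaw ρ p ν T) := by
  have hpast : Measurable fun x : Seed × (Fin T → Outcome M K) =>
      (x.1, fun i : Fin t => x.2 (Fin.castLE t.isLt.le i)) := by fun_prop
  have hh : Measurable fun x : Seed × (Fin T → Outcome M K) =>
      A.history ν x.1 t fun i => x.2 (Fin.castLE t.isLt.le i) :=
    (A.measurable_history t ν).comp hpast
  have hw : Measurable fun x : Seed × (Fin T → Outcome M K) => x.2 t := by fun_prop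
  exact integrable_comp_of_measurableSet_fiber
    (A.measurableSet_probe_action t measurable_fst hh hw)
    (g := fun SC x => totalReward Dmax α p ν SC.1 (x.2 t) SC.2)
    fun SC => (measurePreserving_round p ρ ν t).integrable_comp_of_integrable
      (integrable_totalReward Dmax α p hν SC.1 SC.2)

theorem integrable_regret (hν : ∀ m k, Integrable (fun x => x) (ν m k : Measure ℝ)) :
    Integrable (A.regret Dmax α p ν T) (runLaw ρ p ν T) :=
  (integrable_const _).sub
    (integrable_finsetSum _ fun t _ => A.integrable_reward Dmax α p ρ hν t)

end OnlineAlgorithm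

end Integrability

section Gap

variable {M K : ℕ} (Dmax I : ℕ) (α : ℕ → ℝ) (p : Fin M → PMF ℕ)

/-- The expected loss of one round, relative to the optimal value, when the arms in `S` are probed
and the plays are then assigned according to `c`. -/
noncomputable def gap (ν : Fin M → Fin K → ProbabilityMeasure ℝ) (S : Finset (Fin M))
    (c : Outcome M K → Assignment M K) : ℝ :=
  optimalValue Dmax I α p ν - ∫ w, totalReward Dmax α p ν S w (c w) ∂outcomeLaw p ν

theorem grossReward_le_hTotal (ν : Fin M → Fin K → ProbabilityMeasure ℝ) (S : Finset (Fin M))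
    (w : Outcome M K) (C : Assignment M K) :
    grossReward Dmax p ν S w C ≤ hTotal Dmax p ν S w :=
  Finset.le_sup' (grossReward Dmax p ν S w) (Finset.mem_univ C)

variable {I} {ν : Fin M → Fin K → ProbabilityMeasure ℝ} {S : Finset (Fin M)}
  {c : Outcome M K → Assignment M K}

theorem probingValue_le_optimalValue (hS : S.card ≤ I) :
    probingValue Dmax α p ν S ≤ optimalValue Dmax I α p ν :=
  Finset.le_sup' (probingValue Dmax α p ν) (Finset.mem_filter.2 ⟨Finset.mem_univ S, hS⟩)

theorem gap_eq : gap Dmax I α p ν S c = optimalValue Dmax I α p ν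
    - (1 - α S.card) * ∫ w, grossReward Dmax p ν S w (c w) ∂outcomeLaw p ν := by
  rw [gap, ← integral_const_mul]
  rfl

variable (hν : ∀ m k, Integrable (fun x => x) (ν m k : Measure ℝ))
  (hc : ∀ C, MeasurableSet {w | c w = C})

include hν hc

theorem integrable_grossReward_comp :
    Integrable (fun w => grossReward Dmax p ν S w (c w)) (outcomeLaw p ν) :=
  integrable_comp_of_measurableSet_fiber hc (g := fun C w => grossReward Dmax p ν S w C)
    fun C => integrable_grossReward Dmax p hν S C

theorem optimalValue_sub_probingValue_le_gap (hα : α S.card ≤ 1) :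
    optimalValue Dmax I α p ν - probingValue Dmax α p ν S ≤ gap Dmax I α p ν S c := by
  rw [gap_eq, probingValue]
  gcongr
  · exact integrable_grossReward_comp Dmax p hν hc
  · exact integrable_hTotal Dmax p hν S
  · exact fun w => grossReward_le_hTotal Dmax p ν S w (c w)

theorem mul_integral_hTotal_sub_grossReward_le_gap (hS : S.card ≤ I) :
    (1 - α S.card) *
        ∫ w, (hTotal Dmax p ν S w - grossReward Dmax p ν S w (c w)) ∂outcomeLaw p ν
      ≤ gap Dmax I α p ν S c := by
  rw [gap_eq, integral_sub (integrable_hTotal Dmax p hν S)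
    (integrable_grossReward_comp Dmax p hν hc), mul_sub]
  exact sub_le_sub_right (probingValue_le_optimalValue Dmax α p hS) _

theorem gap_nonneg (hS : S.card ≤ I) (hα : α S.card ≤ 1) : 0 ≤ gap Dmax I α p ν S c :=
  (sub_nonneg.2 (probingValue_le_optimalValue Dmax α p hS)).trans
    (optimalValue_sub_probingValue_le_gap Dmax α p hν hc hα)

end Gap

section Rounds

theorem measurePreserving_insertNth {Ω Seed : Type*} [MeasurableSpace Ω] [MeasurableSpace Seed]
    (ρ : Measure Seed) [SFinite ρ] (Q : Measure Ω) [SigmaFinite Q] {n : ℕ} (t : Fin (n + 1)) :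
    MeasurePreserving
      (fun z : (Seed × (Fin n → Ω)) × Ω => (z.1.1, (t.insertNth z.2 z.1.2 : Fin (n + 1) → Ω)))
      ((ρ.prod (Measure.pi fun _ => Q)).prod Q) (ρ.prod (Measure.pi fun _ => Q)) :=
  ((MeasurePreserving.id ρ).prod
    (((measurePreserving_piFinSuccAbove (fun _ : Fin (n + 1) => Q) t).symm).comp
      Measure.measurePreserving_swap)).comp (measurePreserving_prodAssoc ρ _ Q)

variable {M K I : ℕ} {Seed : Type*} [MeasurableSpace Seed]

namespace OnlineAlgorithm

variable (A : OnlineAlgorithm M K I Seed) (ν : Fin M → Fin K → ProbabilityMeasure ℝ)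

/-- The history before round `t` of a run of `n + 1` rounds, as a function of the internal
randomness and of the outcomes of the `n` rounds other than `t`. -/
noncomputable def pastHistory {n : ℕ} (t : Fin (n + 1)) (x : Seed × (Fin n → Outcome M K)) :
    Fin t → Feedback M K :=
  A.history ν x.1 t fun i => x.2 (Fin.castLE (Nat.le_of_lt_succ t.isLt) i)

/-- The expected loss in round `t` of a run of `n + 1` rounds, given the internal randomness and
the outcomes of the `n` rounds other than `t`. -/
noncomputable def roundGap (Dmax : ℕ) (α : ℕ → ℝ) (p : Fin M → PMF ℕ) {n : ℕ} (t : Fin (n + 1))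
    (x : Seed × (Fin n → Outcome M K)) : ℝ :=
  gap Dmax I α p ν (A.probe t x.1 (A.pastHistory ν t x))
    (A.action t x.1 (A.pastHistory ν t x))

theorem measurableSet_action_fiber (t : ℕ) (u : Seed) (h : Fin t → Feedback M K)
    (C : Assignment M K) : MeasurableSet {w | A.action t u h w = C} :=
  A.measurableSet_action t measurable_const measurable_const measurable_id C

variable (Dmax : ℕ) (α : ℕ → ℝ) (p : Fin M → PMF ℕ) {n : ℕ} (t : Fin (n + 1))

theorem reward_insertNth (x : Seed × (Fin n → Outcome M K)) (w : Outcome M K) :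
    A.reward Dmax α p ν x.1 (t.insertNth w x.2 : Fin (n + 1) → Outcome M K) t
      = totalReward Dmax α p ν (A.probe t x.1 (A.pastHistory ν t x)) w
          (A.action t x.1 (A.pastHistory ν t x) w) := by
  have hpast : (fun i : Fin t => (t.insertNth w x.2 : Fin (n + 1) → Outcome M K)
      (Fin.castLE t.isLt.le i)) = fun i => x.2 (Fin.castLE (Nat.le_of_lt_succ t.isLt) i) := by
    funext i
    have hi : Fin.castLE t.isLt.le i
        = t.succAbove (Fin.castLE (Nat.le_of_lt_succ t.isLt) i) := by
      rw [Fin.succAbove_of_castSucc_lt _ _ (by simp [Fin.lt_def])]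
      rfl
    rw [hi, Fin.insertNth_apply_succAbove]
  simp only [reward, pastHistory, hpast, Fin.insertNth_apply_same]

theorem roundGap_eq (x : Seed × (Fin n → Outcome M K)) :
    A.roundGap ν Dmax α p t x = optimalValue Dmax I α p ν
      - ∫ w, A.reward Dmax α p ν x.1 (t.insertNth w x.2 : Fin (n + 1) → Outcome M K) t
          ∂outcomeLaw p ν := by
  simp only [A.reward_insertNth ν Dmax α p t x]
  rfl

variable {ν} (ρ : Measure Seed) [IsProbabilityMeasure ρ]
  (hν : ∀ m k, Integrable (fun x => x) (ν m k : Measure ℝ))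

include hν

theorem integrable_reward_insertNth :
    Integrable (fun z : (Seed × (Fin n → Outcome M K)) × Outcome M K =>
      A.reward Dmax α p ν z.1.1 (t.insertNth z.2 z.1.2 : Fin (n + 1) → Outcome M K) t)
      ((runLaw ρ p ν n).prod (outcomeLaw p ν)) :=
  (measurePreserving_insertNth ρ (outcomeLaw p ν) t).integrable_comp_of_integrable
    (A.integrable_reward Dmax α p ρ hν t)

theorem integrable_roundGap : Integrable (A.roundGap ν Dmax α p t) (runLaw ρ p ν n) := by
  rw [funext (A.roundGap_eq ν Dmax α p t)]
  exact (integrable_const _).sub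
    (A.integrable_reward_insertNth Dmax α p t ρ hν).integral_prod_left

theorem integral_roundGap :
    ∫ x, A.roundGap ν Dmax α p t x ∂runLaw ρ p ν n
      = optimalValue Dmax I α p ν
        - ∫ x, A.reward Dmax α p ν x.1 x.2 t ∂runLaw ρ p ν (n + 1) := by
  have hi := A.integrable_reward_insertNth Dmax α p t ρ hν
  have hmp := measurePreserving_insertNth ρ (outcomeLaw p ν) t
  have hr := (A.integrable_reward Dmax α p ρ hν t).aestronglyMeasurable
  rw [funext (A.roundGap_eq ν Dmax α p t),
    integral_sub (integrable_const _) hi.integral_prod_left, integral_const, probReal_univ,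
    one_smul, ← integral_prod _ hi, runLaw, runLaw, ← hmp.map_eq,
    integral_map hmp.aemeasurable (hmp.map_eq ▸ hr)]

theorem integral_regret :
    ∫ x, A.regret Dmax α p ν (n + 1) x ∂runLaw ρ p ν (n + 1)
      = ∑ t : Fin (n + 1), ∫ x, A.roundGap ν Dmax α p t x ∂runLaw ρ p ν n := by
  have hr := fun t : Fin (n + 1) => A.integrable_reward Dmax α p ρ hν t
  simp only [regret, A.integral_roundGap Dmax α p _ ρ hν, Finset.sum_sub_distrib]
  rw [integral_sub (integrable_const _) (integrable_finsetSum _ fun t _ => hr t),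
    integral_finsetSum _ fun t _ => hr t, integral_const, probReal_univ, one_smul]

end OnlineAlgorithm

theorem runLaw_withDensity (ρ : Measure Seed) (p : Fin M → PMF ℕ)
    {ν ν' : Fin M → Fin K → ProbabilityMeasure ℝ} {f : Outcome M K → ENNReal} (hf : Measurable f)
    (hν' : outcomeLaw p ν' = (outcomeLaw p ν).withDensity f) (T : ℕ) :
    runLaw ρ p ν' T = (runLaw ρ p ν T).withDensity fun x => ∏ t, f (x.2 t) := by
  have : SigmaFinite ((outcomeLaw p ν).withDensity f) := hν' ▸ inferInstance
  have hpi := pi_withDensity (fun _ : Fin T => outcomeLaw p ν) fun _ => hf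
  have : SFinite ((Measure.pi fun _ : Fin T => outcomeLaw p ν).withDensity
      fun ω => ∏ t, f (ω t)) := hpi ▸ inferInstance
  rw [runLaw, runLaw, hν', hpi]
  exact prod_withDensity_right (by fun_prop)

end Rounds

section SinglePlay

variable {M K : ℕ} {k₀ : Fin K}

theorem topSum_eq_of_single {x : Fin K → ℝ} (h₀ : 0 ≤ x k₀) (h : ∀ k, k ≠ k₀ → x k = 0)
    (C : Finset (Fin K)) {n : ℕ} (hn : 1 ≤ n) : topSum x C n = if k₀ ∈ C then x k₀ else 0 := by
  have hsum : topSum x C n = if k₀ ∈ served x C n then x k₀ else 0 := by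
    rw [topSum, Finset.sum_congr rfl fun k _ => show x k = if k = k₀ then x k₀ else 0 by
      split_ifs with hk
      · rw [hk]
      · exact h k hk, Finset.sum_ite_eq']
  rcases h₀.eq_or_lt with h₀ | h₀
  · simp [hsum, ← h₀]
  have hfirst : ∀ j ∈ C, (if x k₀ < x j ∨ (x j = x k₀ ∧ j < k₀) then 1 else 0) = 0 :=
    fun j _ => if_neg <| by
      rcases eq_or_ne j k₀ with rfl | hj
      · simp
      · simp [h j hj, h₀.ne, h₀.le]
  have hserved : k₀ ∈ served x C n ↔ k₀ ∈ C := by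
    rw [mem_served, Finset.sum_eq_zero hfirst]
    exact and_iff_left hn
  simp only [hsum, hserved]

theorem sum_Icc_toReal_eq_one {Dmax : ℕ} {q : PMF ℕ} (hq : ∀ d, q d ≠ 0 → 1 ≤ d ∧ d ≤ Dmax) :
    ∑ d ∈ Finset.Icc 1 Dmax, (q d).toReal = 1 := by
  rw [← ENNReal.toReal_sum fun d _ => q.apply_ne_top d, ← ENNReal.toReal_one, ← q.tsum_coe,
    tsum_eq_sum fun d hd => not_not.1 fun h => hd (Finset.mem_Icc.2 (hq d h))]

theorem unprobedReward_eq_of_single {Dmax : ℕ} {q : PMF ℕ}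
    (hq : ∀ d, q d ≠ 0 → 1 ≤ d ∧ d ≤ Dmax) {x : Fin K → ℝ} (h₀ : 0 ≤ x k₀)
    (h : ∀ k, k ≠ k₀ → x k = 0) (C : Finset (Fin K)) :
    unprobedReward Dmax q x C = if k₀ ∈ C then x k₀ else 0 := by
  rw [unprobedReward, Finset.sum_congr rfl fun d hd => by
    rw [topSum_eq_of_single h₀ h C (Finset.mem_Icc.1 hd).1], ← Finset.sum_mul,
    sum_Icc_toReal_eq_one hq, one_mul]

/-- The expected reward of play `k` on arm `m`, if it gets a unit of resource, given what probing
`S` reveals. -/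
noncomputable def expectedReward (ν : Fin M → Fin K → ProbabilityMeasure ℝ) (k : Fin K)
    (S : Finset (Fin M)) (w : Outcome M K) (m : Fin M) : ℝ :=
  if m ∈ S then w.2 m k else mean ν m k

theorem grossReward_eq_of_single {Dmax : ℕ} {p : Fin M → PMF ℕ}
    (hp : ∀ m d, p m d ≠ 0 → 1 ≤ d ∧ d ≤ Dmax) {ν : Fin M → Fin K → ProbabilityMeasure ℝ}
    (hν₀ : ∀ m, 0 ≤ mean ν m k₀) (hν : ∀ m k, k ≠ k₀ → mean ν m k = 0) {w : Outcome M K}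
    (hD : ∀ m, 1 ≤ w.1 m) (hX₀ : ∀ m, 0 ≤ w.2 m k₀) (hX : ∀ m k, k ≠ k₀ → w.2 m k = 0)
    (S : Finset (Fin M)) (C : Assignment M K) :
    grossReward Dmax p ν S w C = (C k₀).elim 0 (expectedReward ν k₀ S w) := by
  have hprobed : ∀ m ∈ S, topSum (w.2 m) (plays C m) (w.1 m)
      = if C k₀ = some m then w.2 m k₀ else 0 := fun m _ => by
    simp [topSum_eq_of_single (hX₀ m) (hX m) _ (hD m), plays]
  have hunprobed : ∀ m ∈ Sᶜ, unprobedReward Dmax (p m) (mean ν m) (plays C m)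
      = if C k₀ = some m then mean ν m k₀ else 0 := fun m _ => by
    simp [unprobedReward_eq_of_single (hp m) (hν₀ m) (hν m), plays]
  rw [grossReward, Finset.sum_congr rfl hprobed, Finset.sum_congr rfl hunprobed]
  cases hC : C k₀ with
  | none => simp
  | some m => by_cases hm : m ∈ S <;> simp [hm, expectedReward]

end SinglePlay

section OutcomeLaw

variable {M K : ℕ} (p : Fin M → PMF ℕ) {ν ν' : Fin M → Fin K → ProbabilityMeasure ℝ}

theorem outcomeLaw_real_forall_mem (k : Fin K) (A : Finset (Fin M)) {B : Set ℝ}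
    (hB : MeasurableSet B) :
    (outcomeLaw p ν).real {w | ∀ m ∈ A, w.2 m k ∈ B} = ∏ m ∈ A, (ν m k : Measure ℝ).real B := by
  have hset : {w : Outcome M K | ∀ m ∈ A, w.2 m k ∈ B}
      = Prod.snd ⁻¹' (Set.pi A fun _ => {x : Fin K → ℝ | x k ∈ B}) := by
    ext w
    simp [Set.mem_pi]
  have hB' : MeasurableSet {x : Fin K → ℝ | x k ∈ B} := measurable_pi_apply k hB
  rw [hset, outcomeLaw, measurePreserving_snd.measureReal_preimage
    (MeasurableSet.pi A.countable_toSet fun _ _ => hB').nullMeasurableSet, Measure.real,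
    Measure.pi_pi_finset, ENNReal.toReal_prod]
  exact Finset.prod_congr rfl fun m _ =>
    (measurePreserving_eval (fun k => (ν m k : Measure ℝ)) k).measureReal_preimage
      hB.nullMeasurableSet

theorem outcomeLaw_eq_withDensity {m₀ : Fin M} {k₀ : Fin K} {f : ℝ → ENNReal} (hf : Measurable f)
    (h₀ : (ν' m₀ k₀ : Measure ℝ) = (ν m₀ k₀ : Measure ℝ).withDensity f)
    (h : ∀ m k, (m, k) ≠ (m₀, k₀) → ν' m k = ν m k) :
    outcomeLaw p ν' = (outcomeLaw p ν).withDensity fun w => f (w.2 m₀ k₀) := by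
  have harm := pi_withDensity_single (fun k => (ν m₀ k : Measure ℝ))
    (ν := fun k => (ν' m₀ k : Measure ℝ)) k₀ hf h₀ fun k hk => by rw [h m₀ k (by simp [hk])]
  have hall := pi_withDensity_single (fun m => Measure.pi fun k => (ν m k : Measure ℝ))
    (ν := fun m => Measure.pi fun k => (ν' m k : Measure ℝ)) m₀
    (f := fun x => f (x k₀)) (by fun_prop) harm
    fun m hm => by simp only [h m _ (show (m, _) ≠ (m₀, k₀) by simp [hm])]
  have : SFinite ((Measure.pi fun m => Measure.pi fun k =>
      (ν m k : Measure ℝ)).withDensity fun x => f (x m₀ k₀)) := hall ▸ inferInstance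
  rw [outcomeLaw, outcomeLaw, hall]
  exact prod_withDensity_right (g := fun x : Fin M → Fin K → ℝ => f (x m₀ k₀)) (by fun_prop)

end OutcomeLaw

section HardInstance

/-- The reward law of the live play on the distinguished arm: `9/16` with probability `b` and
`7/16` otherwise, so that the mean crosses `1/2` at `b = 1/2`. -/
noncomputable def coin (b : unitInterval) : ProbabilityMeasure ℝ :=
  ⟨bernoulliMeasure (9 / 16) (7 / 16) b, inferInstance⟩

/-- The bias of the fair coin. -/
noncomputable def half : unitInterval := ⟨1 / 2, by norm_num, by norm_num⟩

/-- The density of `coin b` with respect to `coin half`. -/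
noncomputable def coinDensity (b : unitInterval) (x : ℝ) : ENNReal :=
  2 * ENNReal.ofReal (if x = 9 / 16 then b else unitInterval.symm b)

theorem integral_coin (b : unitInterval) : ∫ x, x ∂(coin b : Measure ℝ) = 7 / 16 + b / 8 := by
  simp only [coin, ProbabilityMeasure.coe_mk, integral_bernoulliMeasure,
    smul_eq_mul]
  ring

theorem ae_coin (b : unitInterval) : ∀ᵐ x ∂(coin b : Measure ℝ), x = 9 / 16 ∨ x = 7 / 16 := by
  rw [ae_iff]
  exact bernoulliMeasure_apply_of_notMem_of_notMem b
    (by measurability) (by simp) (by simp)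

theorem measurable_coinDensity (b : unitInterval) : Measurable (coinDensity b) :=
  (ENNReal.measurable_ofReal.comp
    (Measurable.ite (measurableSet_singleton _) measurable_const measurable_const)).const_mul 2

theorem coin_eq_withDensity (b : unitInterval) :
    (coin b : Measure ℝ) = (coin half : Measure ℝ).withDensity (coinDensity b) := by
  have hhalf : unitInterval.toNNReal half = 2⁻¹ ∧
      unitInterval.toNNReal (unitInterval.symm half) = 2⁻¹ := by
    constructor <;> ext <;> norm_num [half]
  have htwo : ∀ x : unitInterval,
      ((2⁻¹ : NNReal) : ENNReal) * (2 * ENNReal.ofReal x) = unitInterval.toNNReal x := fun x => by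
    rw [ENNReal.coe_inv two_ne_zero, ENNReal.coe_ofNat,
      ENNReal.inv_mul_cancel_left' (by simp) (by simp), ENNReal.ofReal_eq_coe_nnreal x.2.1]
    rfl
  simp only [coin, ProbabilityMeasure.coe_mk, bernoulliMeasure_def, hhalf]
  have := measurable_coinDensity b
  change _ = Measure.withDensity (((2⁻¹ : NNReal) : ENNReal) • Measure.dirac (9 / 16)
    + ((2⁻¹ : NNReal) : ENNReal) • Measure.dirac (7 / 16)) _
  rw [withDensity_add_measure, withDensity_smul_measure, withDensity_smul_measure,
    dirac_withDensity, dirac_withDensity, smul_smul, smul_smul, coinDensity, coinDensity,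
    if_pos rfl, if_neg (by norm_num), htwo, htwo]
  rfl

theorem coinDensity_mul_coinDensity_symm (b : unitInterval) (x : ℝ) :
    coinDensity b x * coinDensity (unitInterval.symm b) x
      = ENNReal.ofReal (4 * (b * (1 - b))) := by
  have hb := unitInterval.nonneg b
  have hb' := unitInterval.one_minus_nonneg b
  rw [coinDensity, coinDensity, ← ENNReal.ofReal_ofNat 2, ← ENNReal.ofReal_mul zero_le_two,
    ← ENNReal.ofReal_mul zero_le_two, ← ENNReal.ofReal_mul (by split_ifs <;> positivity)]
  congr 1
  split_ifs <;> simp only [unitInterval.coe_symm_eq] <;> ring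

theorem ofReal_le_coinDensity {b : unitInterval} {r : ℝ} (hr : r ≤ 2 * b) (hr' : r ≤ 2 * (1 - b))
    (x : ℝ) : ENNReal.ofReal r ≤ coinDensity b x := by
  rw [coinDensity, ← ENNReal.ofReal_ofNat 2, ← ENNReal.ofReal_mul zero_le_two]
  exact ENNReal.ofReal_le_ofReal (by split_ifs <;> assumption)

/-- The reward law of the live play on the other arms: the values `0`, `1/2`, `1` with
probabilities `1/4`, `1/2`, `1/4`. -/
noncomputable def ternary : ProbabilityMeasure ℝ :=
  ⟨(4⁻¹ : NNReal) • Measure.dirac 0 + (2⁻¹ : NNReal) • Measure.dirac (1 / 2)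
    + (4⁻¹ : NNReal) • Measure.dirac 1, ⟨by
      simp only [Measure.coe_add, Measure.coe_nnreal_smul_apply, Pi.add_apply, measure_univ,
        mul_one]
      exact_mod_cast (by norm_num : (4⁻¹ + 2⁻¹ + 4⁻¹ : NNReal) = 1)⟩⟩

theorem integral_ternary : ∫ x, x ∂(ternary : Measure ℝ) = 1 / 2 := by
  have hdirac : ∀ (c : NNReal) (a : ℝ), Integrable (fun x : ℝ => x) (c • Measure.dirac a) :=
    fun c a => (integrable_dirac (by simp)).smul_measure_nnreal
  rw [ternary, ProbabilityMeasure.coe_mk,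
    integral_add_measure ((hdirac _ _).add_measure (hdirac _ _)) (hdirac _ _),
    integral_add_measure (hdirac _ _) (hdirac _ _)]
  norm_num [NNReal.smul_def]

theorem ae_ternary : ∀ᵐ x ∂(ternary : Measure ℝ), x = 0 ∨ x = 1 / 2 ∨ x = 1 := by
  rw [ternary, ProbabilityMeasure.coe_mk]
  simp [ae_dirac_eq]

theorem ternary_real_half : (ternary : Measure ℝ).real {1 / 2} = 1 / 2 := by
  rw [ternary, ProbabilityMeasure.coe_mk]
  norm_num [Measure.real]

theorem ternary_real_compl_one : (ternary : Measure ℝ).real {1}ᶜ = 3 / 4 := by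
  rw [probReal_compl_eq_one_sub (measurableSet_singleton 1), ternary, ProbabilityMeasure.coe_mk]
  norm_num [Measure.real]

end HardInstance

section HardLaw

variable {M K : ℕ} (m₀ : Fin M) (k₀ : Fin K)

/-- The reward laws of the hard instance. Only the live play `k₀` earns anything, so that a round
amounts to choosing one arm; the bias `b` can be learned only by probing or playing the
distinguished arm `m₀`. -/
noncomputable def hardLaw (b : unitInterval) (m : Fin M) (k : Fin K) : ProbabilityMeasure ℝ :=
  if k = k₀ then if m = m₀ then coin b else ternary else diracProba 0

/-- The outcomes to which the hard instance gives full probability. -/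
structure Typical (w : Outcome M K) : Prop where
  resource : ∀ m, 1 ≤ w.1 m
  dead : ∀ m k, k ≠ k₀ → w.2 m k = 0
  coin : w.2 m₀ k₀ = 9 / 16 ∨ w.2 m₀ k₀ = 7 / 16
  ternary : ∀ m, m ≠ m₀ → w.2 m k₀ = 0 ∨ w.2 m k₀ = 1 / 2 ∨ w.2 m k₀ = 1

variable (b : unitInterval)

theorem hardLaw_coin : hardLaw m₀ k₀ b m₀ k₀ = coin b := by simp [hardLaw]

variable {m₀ k₀}

theorem hardLaw_ternary {m : Fin M} (hm : m ≠ m₀) : hardLaw m₀ k₀ b m k₀ = ternary := by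
  simp [hardLaw, hm]

theorem hardLaw_dead (m : Fin M) {k : Fin K} (hk : k ≠ k₀) :
    hardLaw m₀ k₀ b m k = diracProba 0 := by
  simp [hardLaw, hk]

theorem hardLaw_congr (b b' : unitInterval) {m : Fin M} {k : Fin K} (h : (m, k) ≠ (m₀, k₀)) :
    hardLaw m₀ k₀ b m k = hardLaw m₀ k₀ b' m k := by
  unfold hardLaw
  split_ifs with hk hm
  · exact absurd (by rw [hk, hm]) h
  · rfl
  · rfl

theorem mean_hardLaw_coin : mean (hardLaw m₀ k₀ b) m₀ k₀ = 7 / 16 + b / 8 := by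
  rw [mean, hardLaw_coin, integral_coin]

theorem mean_hardLaw_ternary {m : Fin M} (hm : m ≠ m₀) :
    mean (hardLaw m₀ k₀ b) m k₀ = 1 / 2 := by
  rw [mean, hardLaw_ternary b hm, integral_ternary]

theorem mean_hardLaw_dead (m : Fin M) {k : Fin K} (hk : k ≠ k₀) :
    mean (hardLaw m₀ k₀ b) m k = 0 := by
  rw [mean, hardLaw_dead b m hk]
  exact integral_dirac _ _

theorem mean_hardLaw_mem_Icc (m : Fin M) :
    mean (hardLaw m₀ k₀ b) m k₀ ∈ Set.Icc (7 / 16) (9 / 16) := by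
  rcases eq_or_ne m m₀ with rfl | hm
  · rw [mean_hardLaw_coin]
    constructor <;> linarith [unitInterval.nonneg b, unitInterval.le_one b]
  · rw [mean_hardLaw_ternary b hm]
    norm_num

theorem mean_hardLaw_lt_iff (b b' : unitInterval) (m : Fin M) (i j : Fin K) :
    mean (hardLaw m₀ k₀ b) m i < mean (hardLaw m₀ k₀ b) m j
      ↔ mean (hardLaw m₀ k₀ b') m i < mean (hardLaw m₀ k₀ b') m j := by
  have hpos : ∀ b, 0 < mean (hardLaw m₀ k₀ b) m k₀ := fun b =>
    (by norm_num : (0 : ℝ) < 7 / 16).trans_le (mean_hardLaw_mem_Icc b m).1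
  by_cases hi : i = k₀ <;> by_cases hj : j = k₀
  · simp [hi, hj]
  · simp [hi, mean_hardLaw_dead _ m hj, (hpos _).not_gt]
  · simp [hj, mean_hardLaw_dead _ m hi, hpos]
  · simp [mean_hardLaw_dead _ m hi, mean_hardLaw_dead _ m hj]

theorem ae_hardLaw_mem_Icc (m : Fin M) (k : Fin K) :
    ∀ᵐ x ∂(hardLaw m₀ k₀ b m k : Measure ℝ), x ∈ Set.Icc (0 : ℝ) 1 := by
  by_cases hk : k = k₀
  · by_cases hm : m = m₀
    · rw [hk, hm, hardLaw_coin]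
      filter_upwards [ae_coin b] with x hx
      rcases hx with rfl | rfl <;> norm_num
    · rw [hk, hardLaw_ternary b hm]
      filter_upwards [ae_ternary] with x hx
      rcases hx with rfl | rfl | rfl <;> norm_num
  · rw [hardLaw_dead b m hk]
    simp [diracProba, ae_dirac_eq]

theorem integrable_hardLaw (m : Fin M) (k : Fin K) :
    Integrable (fun x => x) (hardLaw m₀ k₀ b m k : Measure ℝ) :=
  Integrable.of_mem_Icc 0 1 aemeasurable_id (ae_hardLaw_mem_Icc b m k)

theorem ae_typical {Dmax : ℕ} {p : Fin M → PMF ℕ} (hp : ∀ m d, p m d ≠ 0 → 1 ≤ d ∧ d ≤ Dmax) :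
    ∀ᵐ w ∂outcomeLaw p (hardLaw m₀ k₀ b), Typical m₀ k₀ w := by
  have hresource : ∀ᵐ w ∂outcomeLaw p (hardLaw m₀ k₀ b), ∀ m, 1 ≤ w.1 m :=
    ae_all_iff.2 fun m => (measurePreserving_resource p _ m).quasiMeasurePreserving.ae <| by
      rw [ae_iff, PMF.toMeasure_apply_eq_zero_iff _ (by measurability), Set.disjoint_left]
      exact fun d hd h => h (hp m d hd).1
  have hreward : ∀ m k, ∀ {P : ℝ → Prop}, (∀ᵐ x ∂(hardLaw m₀ k₀ b m k : Measure ℝ), P x) →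
      ∀ᵐ w ∂outcomeLaw p (hardLaw m₀ k₀ b), P (w.2 m k) := fun m k _ h =>
    (measurePreserving_rewards p _ m k).quasiMeasurePreserving.ae h
  have hdead : ∀ᵐ w ∂outcomeLaw p (hardLaw m₀ k₀ b), ∀ m k, k ≠ k₀ → w.2 m k = 0 := by
    simp only [ae_all_iff]
    exact fun m k hk => hreward m k (P := (· = 0)) <| by
      rw [hardLaw_dead b m hk]
      simp [diracProba, ae_dirac_eq]
  have hcoin := hreward m₀ k₀ (hardLaw_coin m₀ k₀ b ▸ ae_coin b)
  have hternary : ∀ᵐ w ∂outcomeLaw p (hardLaw m₀ k₀ b),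
      ∀ m, m ≠ m₀ → w.2 m k₀ = 0 ∨ w.2 m k₀ = 1 / 2 ∨ w.2 m k₀ = 1 := by
    simp only [ae_all_iff]
    exact fun m hm => hreward m k₀ (hardLaw_ternary b hm ▸ ae_ternary)
  filter_upwards [hresource, hdead, hcoin, hternary] with w h₁ h₂ h₃ h₄ using ⟨h₁, h₂, h₃, h₄⟩

theorem outcomeLaw_hardLaw (p : Fin M → PMF ℕ) :
    outcomeLaw p (hardLaw m₀ k₀ b)
      = (outcomeLaw p (hardLaw m₀ k₀ half)).withDensity fun w => coinDensity b (w.2 m₀ k₀) :=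
  outcomeLaw_eq_withDensity p (measurable_coinDensity b)
    (by rw [hardLaw_coin, hardLaw_coin, ← coin_eq_withDensity]) fun _ _ => hardLaw_congr b half

end HardLaw

section HardReward

variable {M K : ℕ} {m₀ : Fin M} {k₀ : Fin K} {Dmax : ℕ} {p : Fin M → PMF ℕ}
  {S : Finset (Fin M)} {w : Outcome M K} {b : unitInterval}

theorem Typical.reward_mem_Icc (hw : Typical m₀ k₀ w) (m : Fin M) :
    w.2 m k₀ ∈ Set.Icc (0 : ℝ) 1 := by
  rcases eq_or_ne m m₀ with rfl | hm
  · rcases hw.coin with h | h <;> rw [h] <;> norm_num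
  · rcases hw.ternary m hm with h | h | h <;> rw [h] <;> norm_num

theorem expectedReward_hardLaw_le_one (hw : Typical m₀ k₀ w) (m : Fin M) :
    expectedReward (hardLaw m₀ k₀ b) k₀ S w m ≤ 1 := by
  unfold expectedReward
  split_ifs
  · exact (hw.reward_mem_Icc m).2
  · exact (mean_hardLaw_mem_Icc b m).2.trans (by norm_num)

variable (hp : ∀ m d, p m d ≠ 0 → 1 ≤ d ∧ d ≤ Dmax)

include hp

theorem grossReward_hardLaw (hw : Typical m₀ k₀ w) (C : Assignment M K) :
    grossReward Dmax p (hardLaw m₀ k₀ b) S w C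
      = (C k₀).elim 0 (expectedReward (hardLaw m₀ k₀ b) k₀ S w) :=
  grossReward_eq_of_single hp
    (fun m => (by norm_num : (0 : ℝ) ≤ 7 / 16).trans (mean_hardLaw_mem_Icc b m).1)
    (fun m _ => mean_hardLaw_dead b m) hw.resource (fun m => (hw.reward_mem_Icc m).1) hw.dead S C

theorem expectedReward_le_hTotal (hw : Typical m₀ k₀ w) (m : Fin M) :
    expectedReward (hardLaw m₀ k₀ b) k₀ S w m ≤ hTotal Dmax p (hardLaw m₀ k₀ b) S w := by
  simpa [grossReward_hardLaw hp hw] using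
    grossReward_le_hTotal Dmax p (hardLaw m₀ k₀ b) S w fun _ => some m

theorem hTotal_hardLaw_le (hw : Typical m₀ k₀ w) {B : ℝ} (hB : 0 ≤ B)
    (h : ∀ m, expectedReward (hardLaw m₀ k₀ b) k₀ S w m ≤ B) :
    hTotal Dmax p (hardLaw m₀ k₀ b) S w ≤ B :=
  Finset.sup'_le _ _ fun C _ => by
    rw [grossReward_hardLaw hp hw]
    cases C k₀ with
    | none => exact hB
    | some m => exact h m

theorem le_integral_hTotal_empty :
    7 / 16 ≤ ∫ w, hTotal Dmax p (hardLaw m₀ k₀ b) ∅ w ∂outcomeLaw p (hardLaw m₀ k₀ b) := by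
  refine (by simp : (7 / 16 : ℝ) = ∫ _, 7 / 16 ∂outcomeLaw p (hardLaw m₀ k₀ b)).trans_le <|
    integral_mono_ae (integrable_const _) (integrable_hTotal Dmax p (integrable_hardLaw b) ∅) ?_
  filter_upwards [ae_typical b hp] with w hw
  exact (mean_hardLaw_mem_Icc b m₀).1.trans (by
    simpa [expectedReward] using expectedReward_le_hTotal hp hw (b := b) (S := ∅) m₀)

theorem integral_hTotal_le_one :
    ∫ w, hTotal Dmax p (hardLaw m₀ k₀ b) S w ∂outcomeLaw p (hardLaw m₀ k₀ b) ≤ 1 := by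
  refine (integral_mono_ae (integrable_hTotal Dmax p (integrable_hardLaw b) S)
    (integrable_const 1) ?_).trans_eq (by simp)
  filter_upwards [ae_typical b hp] with w hw
  exact hTotal_hardLaw_le hp hw zero_le_one fun m => expectedReward_hardLaw_le_one hw m

end HardReward

section HardGap

theorem integral_one_sub_indicator {Ω : Type*} [MeasurableSpace Ω] (P : Measure Ω)
    [IsProbabilityMeasure P] {E : Set Ω} (hE : MeasurableSet E) (r : ℝ) :
    ∫ x, (1 - E.indicator (fun _ => r) x) ∂P = 1 - P.real E * r := by
  rw [integral_sub (integrable_const 1) ((integrable_const r).indicator hE),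
    integral_indicator_const _ hE]
  simp

theorem measurableSet_forall_mem {M K : ℕ} (k : Fin K) (A : Finset (Fin M)) {B : Set ℝ}
    (hB : MeasurableSet B) : MeasurableSet {w : Outcome M K | ∀ m ∈ A, w.2 m k ∈ B} := by
  simp only [Set.ofPred_forall]
  exact A.measurableSet_biInter fun m _ => (by fun_prop : Measurable _) hB

variable {M K : ℕ} {m₀ : Fin M} {k₀ : Fin K} {Dmax I : ℕ} {p : Fin M → PMF ℕ}
  {S : Finset (Fin M)} {w : Outcome M K} {b : unitInterval}
  (hp : ∀ m d, p m d ≠ 0 → 1 ≤ d ∧ d ≤ Dmax)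

theorem outcomeLaw_hardLaw_real_forall_ne_one (hS : m₀ ∉ S) :
    (outcomeLaw p (hardLaw m₀ k₀ b)).real {w | ∀ m ∈ S, w.2 m k₀ ∈ ({1}ᶜ : Set ℝ)}
      = (3 / 4) ^ S.card := by
  rw [outcomeLaw_real_forall_mem p k₀ S (measurableSet_singleton 1).compl,
    Finset.prod_congr rfl fun m hm => by
      rw [hardLaw_ternary b (ne_of_mem_of_not_mem hm hS), ternary_real_compl_one],
    Finset.prod_const]

include hp

theorem integral_hTotal_le_of_mem (hS : m₀ ∈ S) :
    ∫ w, hTotal Dmax p (hardLaw m₀ k₀ b) S w ∂outcomeLaw p (hardLaw m₀ k₀ b)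
      ≤ 1 - (3 / 4) ^ (S.erase m₀).card * (7 / 16) := by
  have hE := measurableSet_forall_mem k₀ (S.erase m₀) (measurableSet_singleton (1 : ℝ)).compl
  rw [← outcomeLaw_hardLaw_real_forall_ne_one (p := p) (k₀ := k₀) (b := b)
    (Finset.notMem_erase m₀ S), ← integral_one_sub_indicator _ hE]
  refine integral_mono_ae (integrable_hTotal Dmax p (integrable_hardLaw b) S)
    ((integrable_const 1).sub ((integrable_const _).indicator hE)) ?_
  filter_upwards [ae_typical b hp] with w hw
  by_cases hwE : w ∈ {w : Outcome M K | ∀ m ∈ S.erase m₀, w.2 m k₀ ∈ ({1}ᶜ : Set ℝ)}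
  · rw [Set.indicator_of_mem hwE]
    refine hTotal_hardLaw_le hp hw (by norm_num) fun m => ?_
    rw [expectedReward]
    split_ifs with hm
    · rcases eq_or_ne m m₀ with rfl | hm₀
      · rcases hw.coin with h | h <;> rw [h] <;> norm_num
      · have hne : w.2 m k₀ ≠ 1 := hwE m (Finset.mem_erase.2 ⟨hm₀, hm⟩)
        rcases hw.ternary m hm₀ with h | h | h
        · norm_num [h]
        · norm_num [h]
        · exact absurd h hne
    · exact (mean_hardLaw_mem_Icc b m).2.trans (by norm_num)
  · rw [Set.indicator_of_notMem hwE, sub_zero]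
    exact hTotal_hardLaw_le hp hw zero_le_one fun m => expectedReward_hardLaw_le_one hw m

theorem le_integral_hTotal_of_notMem (hS : m₀ ∉ S) :
    1 - (3 / 4) ^ S.card * (9 / 16)
      ≤ ∫ w, hTotal Dmax p (hardLaw m₀ k₀ b) S w ∂outcomeLaw p (hardLaw m₀ k₀ b) := by
  have hE := measurableSet_forall_mem k₀ S (measurableSet_singleton (1 : ℝ)).compl
  rw [← outcomeLaw_hardLaw_real_forall_ne_one (p := p) (k₀ := k₀) (b := b) hS,
    ← integral_one_sub_indicator _ hE]
  refine integral_mono_ae ((integrable_const 1).sub ((integrable_const _).indicator hE))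
    (integrable_hTotal Dmax p (integrable_hardLaw b) S) ?_
  filter_upwards [ae_typical b hp] with w hw
  by_cases hwE : w ∈ {w : Outcome M K | ∀ m ∈ S, w.2 m k₀ ∈ ({1}ᶜ : Set ℝ)}
  · rw [Set.indicator_of_mem hwE]
    have hmean := (mean_hardLaw_mem_Icc (m₀ := m₀) (k₀ := k₀) b m₀).1
    have hplay := expectedReward_le_hTotal hp hw (S := S) (b := b) m₀
    rw [expectedReward, if_neg hS] at hplay
    linarith
  · obtain ⟨m, hm, h1⟩ : ∃ m ∈ S, w.2 m k₀ = 1 := by simpa using hwE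
    rw [Set.indicator_of_notMem hwE, sub_zero, ← h1]
    simpa [expectedReward, hm] using expectedReward_le_hTotal hp hw (S := S) (b := b) m

variable {α : ℕ → ℝ} {c : Outcome M K → Assignment M K} (hc : ∀ C, MeasurableSet {w | c w = C})

include hc

theorem le_gap_of_three_quarters_le (hα₀ : α 0 = 0) (hα : α S.card ≤ 1)
    (hα' : 3 / 4 ≤ α S.card) : 3 / 16 ≤ gap Dmax I α p (hardLaw m₀ k₀ b) S c := by
  have hempty := probingValue_le_optimalValue Dmax α p (ν := hardLaw m₀ k₀ b)
    (S := ∅) (I := I) (by simp)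
  have hgap := optimalValue_sub_probingValue_le_gap Dmax (I := I) α p
    (integrable_hardLaw (m₀ := m₀) (k₀ := k₀) b) hc hα
  have hle := le_integral_hTotal_empty (m₀ := m₀) (k₀ := k₀) (b := b) hp
  have hone := mul_le_mul_of_nonneg_left
    (integral_hTotal_le_one (m₀ := m₀) (k₀ := k₀) (b := b) (S := S) hp) (sub_nonneg.2 hα)
  rw [probingValue, Finset.card_empty, hα₀, sub_zero, one_mul] at hempty
  rw [probingValue] at hgap
  linarith

theorem le_gap_of_mem (hS : S.card ≤ I) (hα : α S.card ≤ 1) (hm₀ : m₀ ∈ S)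
    (hne : S ≠ Finset.univ) :
    (1 - α S.card) * ((3 / 4) ^ M / 64) ≤ gap Dmax I α p (hardLaw m₀ k₀ b) S c := by
  obtain ⟨m₁, hm₁⟩ : ∃ m, m ∉ S := by simpa [Finset.eq_univ_iff_forall] using hne
  have hnotMem : m₀ ∉ insert m₁ (S.erase m₀) := by
    simp [ne_of_mem_of_not_mem hm₀ hm₁]
  have hcard : (insert m₁ (S.erase m₀)).card = (S.erase m₀).card + 1 :=
    Finset.card_insert_of_notMem fun h => hm₁ (Finset.mem_of_mem_erase h)
  have hcard' : (S.erase m₀).card + 1 = S.card := Finset.card_erase_add_one hm₀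
  have hle := le_integral_hTotal_of_notMem (k₀ := k₀) (b := b) hp hnotMem
  have hge := integral_hTotal_le_of_mem (k₀ := k₀) (b := b) hp hm₀
  have hswap := probingValue_le_optimalValue Dmax α p (ν := hardLaw m₀ k₀ b)
    (S := insert m₁ (S.erase m₀)) (I := I) (by rwa [hcard, hcard'])
  have hgap := optimalValue_sub_probingValue_le_gap Dmax (I := I) α p
    (integrable_hardLaw (m₀ := m₀) (k₀ := k₀) b) hc hα
  have hpow : (3 / 4 : ℝ) ^ M ≤ (3 / 4) ^ (S.erase m₀).card :=
    pow_le_pow_of_le_one (by norm_num) (by norm_num) (card_finset_fin_le _)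
  rw [hcard, pow_succ] at hle
  rw [probingValue, hcard, hcard'] at hswap
  refine le_trans ?_ ((sub_le_sub_right hswap _).trans hgap)
  rw [probingValue, ← mul_sub]
  exact mul_le_mul_of_nonneg_left (by linarith) (sub_nonneg.2 hα)

end HardGap

section Unprobed

variable {M K : ℕ} {m₀ : Fin M} {k₀ : Fin K} {Dmax I : ℕ} {p : Fin M → PMF ℕ}
  {S : Finset (Fin M)} {b : unitInterval}

theorem smul_outcomeLaw_half_le {r : ℝ} (hr : r ≤ 2 * b) (hr' : r ≤ 2 * (1 - b)) :
    ENNReal.ofReal r • outcomeLaw p (hardLaw m₀ k₀ half) ≤ outcomeLaw p (hardLaw m₀ k₀ b) := by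
  rw [outcomeLaw_hardLaw b, ← withDensity_const]
  exact withDensity_mono (ae_of_all _ fun w => ofReal_le_coinDensity hr hr' _)

theorem half_pow_le_outcomeLaw_hardLaw_real (b : unitInterval) :
    (1 / 2) ^ M ≤ (outcomeLaw p (hardLaw m₀ k₀ b)).real
      {w | ∀ m ∈ Finset.univ.erase m₀, w.2 m k₀ ∈ ({1 / 2} : Set ℝ)} := by
  rw [outcomeLaw_real_forall_mem p k₀ _ (measurableSet_singleton _),
    Finset.prod_congr rfl fun m hm => by
      rw [hardLaw_ternary b (Finset.ne_of_mem_erase hm), ternary_real_half],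
    Finset.prod_const]
  exact pow_le_pow_of_le_one (by norm_num) (by norm_num) (card_finset_fin_le _)

variable [Nontrivial (Fin M)] (hp : ∀ m d, p m d ≠ 0 → 1 ≤ d ∧ d ≤ Dmax)

include hp

theorem le_hTotal_sub_grossReward_add {w : Outcome M K} (hw : Typical m₀ k₀ w)
    (hwE : ∀ m ∈ Finset.univ.erase m₀, w.2 m k₀ ∈ ({1 / 2} : Set ℝ)) (hS : m₀ ∉ S)
    (C : Assignment M K) :
    ((b : ℝ) - 1 / 2) / 8
      ≤ (hTotal Dmax p (hardLaw m₀ k₀ b) S w - grossReward Dmax p (hardLaw m₀ k₀ b) S w C)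
        + (hTotal Dmax p (hardLaw m₀ k₀ (unitInterval.symm b)) S w
          - grossReward Dmax p (hardLaw m₀ k₀ (unitInterval.symm b)) S w C) := by
  have hcoin : ∀ b, expectedReward (hardLaw m₀ k₀ b) k₀ S w m₀ = 7 / 16 + b / 8 := fun b => by
    rw [expectedReward, if_neg hS, mean_hardLaw_coin]
  have hternary : ∀ b m, m ≠ m₀ → expectedReward (hardLaw m₀ k₀ b) k₀ S w m = 1 / 2 :=
    fun b m hm => by
      have hreward : w.2 m k₀ = 1 / 2 := hwE m (by simpa using hm)
      rw [expectedReward, hreward, mean_hardLaw_ternary b hm, ite_self]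
  obtain ⟨m₁, hm₁⟩ := exists_ne m₀
  have hopt := expectedReward_le_hTotal hp hw (S := S) (b := b) m₀
  have hopt' := expectedReward_le_hTotal hp hw (S := S) (b := unitInterval.symm b) m₁
  rw [hcoin] at hopt
  rw [hternary _ m₁ hm₁] at hopt'
  rw [grossReward_hardLaw hp hw, grossReward_hardLaw hp hw]
  rcases C k₀ with _ | m
  · simp only [Option.elim_none]
    linarith
  · rcases eq_or_ne m m₀ with rfl | hm
    · simp only [Option.elim_some, hcoin, unitInterval.coe_symm_eq]
      linarith
    · simp only [Option.elim_some, hternary _ m hm]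
      linarith

variable {c : Outcome M K → Assignment M K} (hc : ∀ C, MeasurableSet {w | c w = C})

include hc

theorem le_integral_hTotal_sub_grossReward_add (hS : m₀ ∉ S) (hb : (1 / 2 : ℝ) ≤ b)
    (hb' : (b : ℝ) ≤ 3 / 4) :
    (1 / 2) ^ M * (b - 1 / 2) / 16
      ≤ ∫ w, (hTotal Dmax p (hardLaw m₀ k₀ b) S w
          - grossReward Dmax p (hardLaw m₀ k₀ b) S w (c w)) ∂outcomeLaw p (hardLaw m₀ k₀ b)
        + ∫ w, (hTotal Dmax p (hardLaw m₀ k₀ (unitInterval.symm b)) S w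
          - grossReward Dmax p (hardLaw m₀ k₀ (unitInterval.symm b)) S w (c w))
            ∂outcomeLaw p (hardLaw m₀ k₀ (unitInterval.symm b)) := by
  have hE := measurableSet_forall_mem k₀ (Finset.univ.erase m₀)
    (measurableSet_singleton (1 / 2 : ℝ))
  have hPE := half_pow_le_outcomeLaw_hardLaw_real (p := p) (m₀ := m₀) (k₀ := k₀) half
  have hint := fun b => (integrable_hTotal Dmax p (integrable_hardLaw b) S).sub
    (integrable_grossReward_comp Dmax p (S := S)
      (integrable_hardLaw (m₀ := m₀) (k₀ := k₀) b) hc)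
  have hnonneg := fun b w => sub_nonneg.2
    (grossReward_le_hTotal Dmax p (hardLaw m₀ k₀ b) S w (c w))
  have hle := mul_measureReal_le_integral_add
    (smul_outcomeLaw_half_le (r := 1 / 2) (by linarith) (by linarith))
    (smul_outcomeLaw_half_le (r := 1 / 2)
      (by rw [unitInterval.coe_symm_eq]; linarith) (by rw [unitInterval.coe_symm_eq]; linarith))
    (hint b) (hint (unitInterval.symm b)) (hnonneg b) (hnonneg _) hE
    (Measure.ae_smul_measure ((ae_typical half hp).mono fun w hw hwE =>
      le_hTotal_sub_grossReward_add hp hw hwE hS (c w)) _)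
  rw [measureReal_ennreal_smul_apply, ENNReal.toReal_ofReal (by norm_num)] at hle
  refine le_trans ?_ hle
  nlinarith [mul_le_mul_of_nonneg_left hPE (sub_nonneg.2 hb)]

variable {α : ℕ → ℝ}

theorem le_gap_add_gap_of_notMem (hS : S.card ≤ I) (hα : α S.card ≤ 1) (hm₀ : m₀ ∉ S)
    (hb : (1 / 2 : ℝ) ≤ b) (hb' : (b : ℝ) ≤ 3 / 4) :
    (1 - α S.card) * ((1 / 2) ^ M * (b - 1 / 2) / 16)
      ≤ gap Dmax I α p (hardLaw m₀ k₀ b) S c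
        + gap Dmax I α p (hardLaw m₀ k₀ (unitInterval.symm b)) S c := by
  have hgap := fun b => mul_integral_hTotal_sub_grossReward_le_gap Dmax α p
    (integrable_hardLaw (m₀ := m₀) (k₀ := k₀) b) hc hS
  refine le_trans ?_ (add_le_add (hgap b) (hgap (unitInterval.symm b)))
  rw [← mul_add]
  exact mul_le_mul_of_nonneg_left
    (le_integral_hTotal_sub_grossReward_add hp hc hm₀ hb hb') (sub_nonneg.2 hα)

theorem le_gap_add_gap (hα₀ : α 0 = 0) (hα : ∀ i ≤ I, α i ≤ 1) (hαM : M ≤ I → α M = 1)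
    (hS : S.card ≤ I) (hb : (1 / 2 : ℝ) ≤ b) (hb' : (b : ℝ) ≤ 3 / 4) :
    (1 / 2) ^ M / 64 * (b - 1 / 2)
      ≤ gap Dmax I α p (hardLaw m₀ k₀ b) S c
        + gap Dmax I α p (hardLaw m₀ k₀ (unitInterval.symm b)) S c := by
  have hα₁ := hα S.card hS
  have hgap₀ := gap_nonneg Dmax α p
    (integrable_hardLaw (m₀ := m₀) (k₀ := k₀) (unitInterval.symm b)) hc hS hα₁
  have hhalf : 0 < (1 / 2 : ℝ) ^ M := by positivity
  have hhalf_le_one : (1 / 2 : ℝ) ^ M ≤ 1 := pow_le_one₀ (by norm_num) (by norm_num)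
  have hhalf_le : (1 / 2 : ℝ) ^ M ≤ (3 / 4) ^ M :=
    pow_le_pow_left₀ (by norm_num) (by norm_num) M
  rcases le_or_gt (3 / 4) (α S.card) with hexpensive | hcheap
  · have hgap := le_gap_of_three_quarters_le (I := I) (m₀ := m₀) (k₀ := k₀) (b := b) hp hc hα₀ hα₁
      hexpensive
    nlinarith
  · by_cases hm₀ : m₀ ∈ S
    · have hne : S ≠ Finset.univ := by
        rintro rfl
        rw [Finset.card_univ, Fintype.card_fin] at hS hcheap
        linarith [hαM hS]
      have hgap := le_gap_of_mem (k₀ := k₀) (b := b) hp hc hS hα₁ hm₀ hne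
      nlinarith
    · have hgap := le_gap_add_gap_of_notMem (k₀ := k₀) hp hc hS hα₁ hm₀ hb hb'
      have hloss : 0 ≤ (1 / 2 : ℝ) ^ M * (b - 1 / 2) := mul_nonneg hhalf.le (sub_nonneg.2 hb)
      nlinarith

end Unprobed

section RunDensity

variable {M K : ℕ} {Seed : Type*} {n : ℕ} (m₀ : Fin M) (k₀ : Fin K) (b : unitInterval)

/-- The likelihood ratio of a run in the hard instance of bias `b` against the one of bias
`1/2`. -/
noncomputable def runDensity (x : Seed × (Fin n → Outcome M K)) : ENNReal :=
  ∏ t, coinDensity b ((x.2 t).2 m₀ k₀)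

theorem runDensity_mul_runDensity_symm (x : Seed × (Fin n → Outcome M K)) :
    runDensity m₀ k₀ b x * runDensity m₀ k₀ (unitInterval.symm b) x
      = ENNReal.ofReal ((4 * (b * (1 - b))) ^ n) := by
  have hpos : 0 ≤ 4 * ((b : ℝ) * (1 - b)) :=
    mul_nonneg zero_le_four (mul_nonneg b.2.1 (unitInterval.one_minus_nonneg b))
  rw [runDensity, runDensity, ← Finset.prod_mul_distrib, ENNReal.ofReal_pow hpos]
  simp only [coinDensity_mul_coinDensity_symm, Finset.prod_const, Finset.card_univ,
    Fintype.card_fin]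

variable [MeasurableSpace Seed]

theorem measurable_runDensity :
    Measurable (runDensity (Seed := Seed) (n := n) m₀ k₀ b) :=
  Finset.measurable_prod _ fun t _ => (measurable_coinDensity b).comp (by fun_prop)

variable (p : Fin M → PMF ℕ) (ρ : Measure Seed)

theorem runLaw_hardLaw : runLaw ρ p (hardLaw m₀ k₀ b) n
    = (runLaw ρ p (hardLaw m₀ k₀ half) n).withDensity (runDensity m₀ k₀ b) :=
  runLaw_withDensity ρ p (f := fun w => coinDensity b (w.2 m₀ k₀))
    ((measurable_coinDensity b).comp (by fun_prop)) (outcomeLaw_hardLaw b p) n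

theorem lintegral_runDensity [IsProbabilityMeasure ρ] :
    ∫⁻ x, runDensity m₀ k₀ b x ∂runLaw ρ p (hardLaw m₀ k₀ half) n = 1 := by
  rw [← setLIntegral_univ, ← withDensity_apply _ .univ, ← runLaw_hardLaw, measure_univ]

end RunDensity

section Bias

theorem one_div_four_mul_sqrt_le (T : ℕ) : 1 / (4 * √(T : ℝ)) ≤ 1 / 4 := by
  rcases T.eq_zero_or_pos with rfl | hT
  · norm_num
  · refine one_div_le_one_div_of_le (by norm_num) (le_mul_of_one_le_right (by norm_num) ?_)
    exact Real.one_le_sqrt.2 (by exact_mod_cast hT)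

/-- The larger of the two biases of the hard instances for `T` rounds. At distance of order `1/√T`
from `1/2`, `T` tosses do not yet reliably tell the two coins apart. -/
noncomputable def bias (T : ℕ) : unitInterval :=
  ⟨1 / 2 + 1 / (4 * √T), by positivity, by linarith [one_div_four_mul_sqrt_le T]⟩

theorem bias_mem_Icc (T : ℕ) : (bias T : ℝ) ∈ Set.Icc (1 / 2) (3 / 4) :=
  ⟨le_add_of_nonneg_right (by positivity), by
    linarith [one_div_four_mul_sqrt_le T, show (bias T : ℝ) = 1 / 2 + 1 / (4 * √T) from rfl]⟩

theorem mul_bias_sub_half (T : ℕ) : T * ((bias T : ℝ) - 1 / 2) = √T / 4 := by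
  rw [bias, add_sub_cancel_left, mul_one_div, mul_comm 4, ← div_div, Real.div_sqrt]

theorem three_quarters_le_pow_bias (n : ℕ) :
    3 / 4 ≤ (4 * (bias (n + 1) * (1 - bias (n + 1))) : ℝ) ^ n := by
  have hbias : 4 * (bias (n + 1) * (1 - bias (n + 1))) = 1 + -(1 / (4 * (n + 1 : ℝ))) := by
    have hsq : √((n + 1 : ℕ) : ℝ) ^ 2 = n + 1 := by
      rw [Real.sq_sqrt (Nat.cast_nonneg _), Nat.cast_add_one]
    rw [bias, ← hsq]
    field_simp
    ring
  have hle : (n : ℝ) * (1 / (4 * (n + 1))) ≤ 1 / 4 := by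
    rw [mul_one_div, div_le_div_iff₀ (by positivity) (by norm_num)]
    linarith
  have hone : 1 / (4 * (n + 1 : ℝ)) ≤ 1 := by
    rw [div_le_one (by positivity)]
    linarith [n.cast_nonneg (α := ℝ)]
  rw [hbias]
  linarith [one_add_mul_le_pow (a := -(1 / (4 * (n + 1 : ℝ)))) (by linarith) n]

end Bias

namespace OnlineAlgorithm

variable {M K I : ℕ} {Seed : Type*} [MeasurableSpace Seed] (A : OnlineAlgorithm M K I Seed)
  {m₀ : Fin M} {k₀ : Fin K} {Dmax : ℕ} {α : ℕ → ℝ} {p : Fin M → PMF ℕ}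
  {n : ℕ} (t : Fin (n + 1)) (b : unitInterval)

theorem pastHistory_hardLaw_eq (b b' : unitInterval) (x : Seed × (Fin n → Outcome M K)) :
    A.pastHistory (hardLaw m₀ k₀ b) t x = A.pastHistory (hardLaw m₀ k₀ b') t x :=
  A.history_congr t (mean_hardLaw_lt_iff b b') _ _

theorem roundGap_hardLaw_nonneg (hα : ∀ i ≤ I, α i ≤ 1) (x : Seed × (Fin n → Outcome M K)) :
    0 ≤ A.roundGap (hardLaw m₀ k₀ b) Dmax α p t x :=
  gap_nonneg Dmax α p (integrable_hardLaw b) (A.measurableSet_action_fiber t x.1 _)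
    (A.card_probe_le _ _ _) (hα _ (A.card_probe_le _ _ _))

variable {b} [Nontrivial (Fin M)] (hp : ∀ m d, p m d ≠ 0 → 1 ≤ d ∧ d ≤ Dmax) (hα₀ : α 0 = 0)
  (hα : ∀ i ≤ I, α i ≤ 1) (hαM : M ≤ I → α M = 1)

include hp hα₀ hα hαM

theorem le_roundGap_add_roundGap (hb : (1 / 2 : ℝ) ≤ b) (hb' : (b : ℝ) ≤ 3 / 4)
    (x : Seed × (Fin n → Outcome M K)) :
    (1 / 2) ^ M / 64 * (b - 1 / 2)
      ≤ A.roundGap (hardLaw m₀ k₀ b) Dmax α p t x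
        + A.roundGap (hardLaw m₀ k₀ (unitInterval.symm b)) Dmax α p t x := by
  rw [roundGap, roundGap, A.pastHistory_hardLaw_eq t (unitInterval.symm b) b x]
  exact le_gap_add_gap hp (A.measurableSet_action_fiber t x.1 _) hα₀ hα hαM
    (A.card_probe_le _ _ _) hb hb'

theorem le_integral_roundGap_add (hb : (1 / 2 : ℝ) ≤ b) (hb' : (b : ℝ) ≤ 3 / 4)
    (ρ : Measure Seed) [IsProbabilityMeasure ρ] :
    (1 / 2) ^ M / 64 * (b - 1 / 2) * ((4 * (b * (1 - b))) ^ n / 2)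
      ≤ ∫ x, A.roundGap (hardLaw m₀ k₀ b) Dmax α p t x ∂runLaw ρ p (hardLaw m₀ k₀ b) n
        + ∫ x, A.roundGap (hardLaw m₀ k₀ (unitInterval.symm b)) Dmax α p t x
            ∂runLaw ρ p (hardLaw m₀ k₀ (unitInterval.symm b)) n := by
  have hint : ∀ b, Integrable (A.roundGap (hardLaw m₀ k₀ b) Dmax α p t)
      ((runLaw ρ p (hardLaw m₀ k₀ half) n).withDensity (runDensity m₀ k₀ b)) := fun b =>
    runLaw_hardLaw m₀ k₀ b p ρ ▸ A.integrable_roundGap Dmax α p t ρ (integrable_hardLaw b)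
  have hone := fun b => (lintegral_runDensity (n := n) m₀ k₀ b p ρ).le
  have hδ : 0 ≤ (1 / 2 : ℝ) ^ M / 64 * (b - 1 / 2) :=
    mul_nonneg (by positivity) (sub_nonneg.2 hb)
  rw [runLaw_hardLaw m₀ k₀ b, runLaw_hardLaw m₀ k₀ (unitInterval.symm b)]
  exact mul_div_two_le_integral_add (measurable_runDensity m₀ k₀ b)
    (measurable_runDensity m₀ k₀ _) (hone b) (hone _) (runDensity_mul_runDensity_symm m₀ k₀ b)
    (hint b) (hint _) (A.roundGap_hardLaw_nonneg t b hα) (A.roundGap_hardLaw_nonneg t _ hα) hδ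
    (A.le_roundGap_add_roundGap t hp hα₀ hα hαM hb hb')

theorem le_integral_regret_add (ρ : Measure Seed) [IsProbabilityMeasure ρ] (m₀ : Fin M)
    (k₀ : Fin K) (n : ℕ) :
    2 * ((1 / 2) ^ M * (3 / 4096) * √(n + 1 : ℕ))
      ≤ ∫ x, A.regret Dmax α p (hardLaw m₀ k₀ (bias (n + 1))) (n + 1) x
          ∂runLaw ρ p (hardLaw m₀ k₀ (bias (n + 1))) (n + 1)
        + ∫ x, A.regret Dmax α p (hardLaw m₀ k₀ (unitInterval.symm (bias (n + 1)))) (n + 1) x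
            ∂runLaw ρ p (hardLaw m₀ k₀ (unitInterval.symm (bias (n + 1)))) (n + 1) := by
  rw [A.integral_regret Dmax α p ρ (integrable_hardLaw _),
    A.integral_regret Dmax α p ρ (integrable_hardLaw _), ← Finset.sum_add_distrib]
  refine le_trans ?_ (Finset.card_nsmul_le_sum Finset.univ _ _ fun t _ =>
    A.le_integral_roundGap_add t hp hα₀ hα hαM (bias_mem_Icc (n + 1)).1
      (bias_mem_Icc (n + 1)).2 ρ)
  rw [Finset.card_univ, Fintype.card_fin, nsmul_eq_mul]
  calc 2 * ((1 / 2) ^ M * (3 / 4096) * √(n + 1 : ℕ))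
      = (1 / 2) ^ M / 128 * (√(n + 1 : ℕ) / 4) * (3 / 4) := by ring
    _ ≤ (1 / 2) ^ M / 128 * (√(n + 1 : ℕ) / 4)
          * (4 * (bias (n + 1) * (1 - bias (n + 1)))) ^ n :=
        mul_le_mul_of_nonneg_left (three_quarters_le_pow_bias n) (by positivity)
    _ = _ := by
        rw [← mul_bias_sub_half]
        ring

end OnlineAlgorithm

end PUCS

theorem mainTheorem4_general (M : ℕ) (hM : 2 ≤ M) :
    ∃ c : ℝ, 0 < c ∧
      ∀ (K Dmax I T : ℕ), 1 ≤ K → 1 ≤ T →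
      ∀ α : ℕ → ℝ, α 0 = 0 → (∀ i ≤ I, α i ≤ 1) → (M ≤ I → α M = 1) →
      ∀ p : Fin M → PMF ℕ, (∀ m d, p m d ≠ 0 → 1 ≤ d ∧ d ≤ Dmax) →
      ∀ (Seed : Type*) [MeasurableSpace Seed] (ρ : Measure Seed) [IsProbabilityMeasure ρ]
        (A : PUCS.OnlineAlgorithm M K I Seed),
      ∃ ν : Fin M → Fin K → ProbabilityMeasure ℝ,
        (∀ m k, (ν m k : Measure ℝ) (Set.Icc (0 : ℝ) 1)ᶜ = 0) ∧
        Integrable (A.regret Dmax α p ν T) (PUCS.runLaw ρ p ν T) ∧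
        c * Real.sqrt T ≤ ∫ x, A.regret Dmax α p ν T x ∂(PUCS.runLaw ρ p ν T) := by
  refine ⟨(1 / 2) ^ M * (3 / 4096), by positivity, ?_⟩
  intro K Dmax I T hK hT α hα₀ hα hαM p hp Seed _ ρ _ A
  obtain ⟨n, rfl⟩ := Nat.exists_eq_add_of_le' hT
  have : Nontrivial (Fin M) := Fin.nontrivial_iff_two_le.2 hM
  let ν := PUCS.hardLaw (⟨0, by omega⟩ : Fin M) (⟨0, hK⟩ : Fin K)
  have hν : ∀ b, Integrable (A.regret Dmax α p (ν b) (n + 1))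
      (PUCS.runLaw ρ p (ν b) (n + 1)) := fun b =>
    A.integrable_regret Dmax α p ρ (PUCS.integrable_hardLaw b)
  have hsum := A.le_integral_regret_add hp hα₀ hα hαM ρ ⟨0, by omega⟩ ⟨0, hK⟩ n
  suffices ∃ b, (1 / 2) ^ M * (3 / 4096) * √(n + 1 : ℕ)
      ≤ ∫ x, A.regret Dmax α p (ν b) (n + 1) x ∂PUCS.runLaw ρ p (ν b) (n + 1) by
    obtain ⟨b, hb⟩ := this
    exact ⟨ν b, PUCS.ae_hardLaw_mem_Icc b, hν b, hb⟩
  by_contra! h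
  linarith [h (PUCS.bias (n + 1)), h (unitInterval.symm (PUCS.bias (n + 1)))]

theorem mainTheorem4 (M : ℕ) (hM : 2 ≤ M) :
    ∃ c : ℝ, 0 < c ∧
      ∀ (K Dmax I T : ℕ), 1 ≤ K → 1 ≤ I → I ≤ M → 1 ≤ T →
      ∀ α : ℕ → ℝ, α 0 = 0 → α I = 1 → (∀ i j, i ≤ j → j ≤ I → α i ≤ α j) →
      ∀ p : Fin M → PMF ℕ, (∀ m d, p m d ≠ 0 → 1 ≤ d ∧ d ≤ Dmax) →
      ∀ (Seed : Type*) [MeasurableSpace Seed] (ρ : Measure Seed) [IsProbabilityMeasure ρ]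
        (A : PUCS.OnlineAlgorithm M K I Seed),
      ∃ ν : Fin M → Fin K → ProbabilityMeasure ℝ,
        (∀ m k, (ν m k : Measure ℝ) (Set.Icc (0 : ℝ) 1)ᶜ = 0) ∧
        Integrable (A.regret Dmax α p ν T) (PUCS.runLaw ρ p ν T) ∧
        c * Real.sqrt T ≤ ∫ x, A.regret Dmax α p ν T x ∂(PUCS.runLaw ρ p ν T) := by
  obtain ⟨c, hc, h⟩ := mainTheorem4_general M hM
  exact ⟨c, hc, fun K Dmax I T hK _ hI hT α hα₀ hαI hα => h K Dmax I T hK hT α hα₀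
    (fun i hi => (hα i I hi le_rfl).trans_eq hαI) fun hM' => le_antisymm hI hM' ▸ hαI⟩
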